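/- Write $\mathbf F_3((X^{-1}))$ for the field of formal Laurent series in $X^{-1}$ over $\mathbf F_3$. Put $|0|=0$, and $|F|=2^m$ if $F=\sum_{h\ge -m} f_hX^{-h}$ with $f_{-m}\neq 0$; let $\|F\|$ be the norm of the fractional part $\sum_{h\ge 1}f_hX^{-h}$ of $F$. A pair $(\Theta,\Phi)$ satisfies the Littlewood conjecture if $\inf_{q\in \mathbf F_3[X]\setminus\{0\}} |q|\cdot\|q\Theta\|\cdot\|q\Phi\|=0$. It satisfies it non-trivially if moreover $\inf_{q\neq 0}|q|\cdot\|q\Theta\|>0$, $\inf_{q\ne 0}|q|\cdot\|q\Phi\|>0$, and $1,\Theta,\Phi$ are linearly independent over $\mathbf F_3[X]$. A series is quartic if it is algebraic of degree $4$ over $\mathbf F_3(X)$. For integers $k,n\ge 0$ put $u_n=(k+2)3^n-2$ and let $H_n(X)$ be the finite word $$H_n(X)=(X+1)\,X^{[u_n]}\,(X+1)$$ over $\mathbf F_3[X]$, where $X^{[u]}$ denotes the letter $X$ repeated $u$ times. Let $$\Theta(k)=[0,H_0(X),H_1(-X),H_2(X),\ldots,H_n((-1)^nX),\ldots]$$ be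 the power series in $\mathbf F_3((X^{-1}))$ whose partial quotients are $0$ followed by the successive letters of these words. **Theorem.** For every integer $k\ge 0$, this continued fraction converges, its value $\Theta(k)$ is quartic, and the pair $(\Theta(k),\Theta(k)^{-1})$ satisfies the Littlewood conjecture. In particular, there exist infinitely many pairs of quartic power series in $\mathbf F_3((X^{-1}))$ satisfying the Littlewood conjecture non-trivially. -/

import Mathlib

open Polynomial Filter Topology

noncomputable section

namespace PowerSeriesLittlewood

/-!
The field `k((X⁻¹))` is Mathlib's `LaurentSeries K`, whose formal variable stands for `X⁻¹`.
So the coefficient of index `h` of `F : LaurentSeries K` is the coefficient of `X ^ (-h)` in `F`.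
-/

/-- The element `X` of `k((X⁻¹))`, that is, the inverse of the formal variable. -/
def xElt (K : Type*) [Field K] : LaurentSeries K := HahnSeries.single (-1 : ℤ) (1 : K)

/-- The embedding of the polynomial ring `k[X]` in `k((X⁻¹))`. -/
def polyEmb (K : Type*) [Field K] : K[X] →+* LaurentSeries K :=
  Polynomial.eval₂RingHom HahnSeries.C (xElt K)

/-- The field `k(X)` of rational functions, as the subfield of `k((X⁻¹))` generated by `k[X]`. -/
def ratFunField (K : Type*) [Field K] : Subfield (LaurentSeries K) :=
  Subfield.closure (Set.range (polyEmb K))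

/-- The norm: `|0| = 0`, and `|F| = 2 ^ m` if `F = ∑_{h ≥ -m} f_h X ^ (-h)` with `f_{-m} ≠ 0`. -/
def absv {K : Type*} [Field K] (F : LaurentSeries K) : ℝ :=
  open Classical in if F = 0 then 0 else (2 : ℝ) ^ (-F.order)

/-- The fractional part: the part of the series with only the negative powers of `X`. -/
def fracPart {K : Type*} [Field K] (F : LaurentSeries K) : LaurentSeries K where
  coeff h := if 0 < h then F.coeff h else 0
  isPWO_support' := F.isPWO_support.mono fun h hh => by
    simp only [Function.mem_support, HahnSeries.mem_support] at hh ⊢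
    intro h0
    simp [h0] at hh

/-- `‖F‖`, the norm of the fractional part. -/
def fracNorm {K : Type*} [Field K] (F : LaurentSeries K) : ℝ := absv (fracPart F)

/-- `(Θ, Φ)` satisfies the Littlewood conjecture: the infimum over nonzero polynomials `q` of
`|q| ‖q Θ‖ ‖q Φ‖` is zero. -/
def Littlewood {K : Type*} [Field K] (Θ Φ : LaurentSeries K) : Prop :=
  ⨅ q : {q : K[X] // q ≠ 0},
    absv (polyEmb K q) * fracNorm (polyEmb K q * Θ) * fracNorm (polyEmb K q * Φ) = 0

/-- Badly approximable series: the infimum over nonzero polynomials `q` of `|q| ‖q Θ‖` is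
positive. -/
def IsBad {K : Type*} [Field K] (Θ : LaurentSeries K) : Prop :=
  0 < ⨅ q : {q : K[X] // q ≠ 0}, absv (polyEmb K q) * fracNorm (polyEmb K q * Θ)

/-- `(Θ, Φ)` satisfies the Littlewood conjecture non-trivially: moreover `Θ` and `Φ` are badly
approximable, and `1, Θ, Φ` are linearly independent over `k[X]`. -/
def LittlewoodNontrivially {K : Type*} [Field K] (Θ Φ : LaurentSeries K) : Prop :=
  Littlewood Θ Φ ∧ IsBad Θ ∧ IsBad Φ ∧
    ∀ a b c : K[X], polyEmb K a + polyEmb K b * Θ + polyEmb K c * Φ = 0 → a = 0 ∧ b = 0 ∧ c = 0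

/-- `Θ` is quartic: algebraic of degree exactly `4` over the subfield `k(X)` of `k((X⁻¹))`.
(The minimal polynomial of a non-algebraic element is `0` in Mathlib, of degree `0`.) -/
def IsQuartic {K : Type*} [Field K] (Θ : LaurentSeries K) : Prop :=
  (minpoly (ratFunField K) Θ).natDegree = 4

/-- The formal continued fraction `[a 0, a 1, a 2, …]` over `k((X⁻¹))`, for polynomials `a i`. -/
def contFrac {K : Type*} [Field K] (a : ℕ → K[X]) : GenContFract (LaurentSeries K) where
  h := polyEmb K (a 0)
  s := Stream'.Seq.ofStream fun n => ⟨1, polyEmb K (a (n + 1))⟩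

/-- `Θ` has the continued fraction expansion `[a 0, a 1, a 2, …]`: the partial quotients of
positive index are nonconstant polynomials, and the convergents tend to `Θ`. -/
def HasContFrac {K : Type*} [Field K] (a : ℕ → K[X]) (Θ : LaurentSeries K) : Prop :=
  (∀ i, 1 ≤ i → 1 ≤ (a i).natDegree) ∧
    Tendsto (fun n => absv (Θ - (contFrac a).convs n)) atTop (𝓝 0)

/-- The series with continued fraction expansion `[a 0, a 1, a 2, …]`. -/
def contFracValue {K : Type*} [Field K] (a : ℕ → K[X]) : LaurentSeries K :=
  Classical.epsilon (HasContFrac a)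

/-- The letter of index `i` (from `0`) of the infinite word `w 0 w 1 w 2 …`, where every `w n` is a
nonempty finite word. -/
def infiniteConcat {A : Type*} [Zero A] (w : ℕ → List A) (i : ℕ) : A :=
  ((List.range (i + 1)).flatMap w).getD i 0

/-- `u_n = (k + 2) 3 ^ n - 2`; the subtraction is never truncated. -/
def u (k n : ℕ) : ℕ := (k + 2) * 3 ^ n - 2

/-- The word `H_n(X) = (X + 1) X^{[u_n]} (X + 1)` over `F_3[X]`. -/
def H (k n : ℕ) : List (ZMod 3)[X] := [X + 1] ++ List.replicate (u k n) X ++ [X + 1]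

/-- The partial quotients of `[0, H_0(X), H_1(-X), H_2(X), …, H_n((-1)^n X), …]`. -/
def partialQuotient (k : ℕ) : ℕ → (ZMod 3)[X]
  | 0 => 0
  | i + 1 => infiniteConcat (fun n => (H k n).map fun P => P.comp ((-1) ^ n * X)) i

/-- The series `Θ(k) = [0, H_0(X), H_1(-X), H_2(X), …, H_n((-1)^n X), …]`. -/
def Theta (k : ℕ) : LaurentSeries (ZMod 3) := contFracValue (partialQuotient k)

end PowerSeriesLittlewood

end

noncomputable section

namespace PowerSeriesLittlewood

/-! ### Norm, polynomial part and completeness -/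

section Norm

variable {K : Type*} [Field K]

/-! Write `J(a)` for the matrix `!![a, 1; 1, 0]`. Products of such matrices along a prefix of the
partial quotients give the convergents. All partial quotients are linear, so errors are known
exactly, and `Θ` and `Θ⁻¹` are badly approximable (`half_le`, `isBad_inv`).

Littlewood: the word of `Θ` contains prefixes `w v` with `v` a palindrome much longer than `w`. The
matrix of `w v w.reverse` is symmetric and still approximates `Θ` well. Its off-diagonal entry `q`
is then close to a denominator for both `Θ` and `Θ⁻¹` (`exists_littlewood_le`), and the product
tends to `0` as `w` grows.

No quadratic equation: a relation `a + b Θ + c Θ² = 0` defines a linear form on symmetric matrices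
which vanishes on those `A J(±X) ^ j Aᵀ` that end inside a long run of `±X` (`trace_eq_zero`). One
run determines the form up to a factor; the junction with the next run forces that factor to be `0`
(`Theta_not_quadratic`).

Quartic equation: in characteristic 3, `J(X) ^ 3` is intertwined with `J(X ^ 3)`, the Frobenius
image of `J(X)`. Each block is a power of `J(X)` between constant matrices, and the exponent triples
from block to block. Hence cubing the matrix of `n` blocks essentially gives that of `n + 1` blocks,
so `Θ` is a homography of `Θ³` (`Theta_quartic_relation`). This equation has no root modulo `X`,
hence no linear factor over the rational functions; with no equation of degree at most 2 either, the
degree is exactly 4. -/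

theorem absv_le_iff {F : LaurentSeries K} {j : ℤ} :
    absv F ≤ (2 : ℝ) ^ (-j) ↔ ∀ h < j, F.coeff h = 0 := by
  unfold absv
  split_ifs with hF
  · subst hF
    simp only [HahnSeries.coeff_zero, implies_true, iff_true]
    positivity
  · rw [zpow_le_zpow_iff_right₀ (by norm_num : (1 : ℝ) < 2), neg_le_neg_iff]
    constructor
    · intro h i hi
      exact HahnSeries.coeff_eq_zero_of_lt_order (lt_of_lt_of_le hi h)
    · intro h
      by_contra! hlt
      exact HahnSeries.coeff_order_eq_zero.not.mpr hF (h _ hlt)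

theorem absv_zero : absv (0 : LaurentSeries K) = 0 := by simp [absv]

theorem absv_of_ne_zero {F : LaurentSeries K} (hF : F ≠ 0) :
    absv F = (2 : ℝ) ^ (-F.order) := by simp [absv, hF]

theorem absv_nonneg (F : LaurentSeries K) : 0 ≤ absv F := by
  unfold absv
  split_ifs <;> positivity

theorem absv_mul (F G : LaurentSeries K) : absv (F * G) = absv F * absv G := by
  by_cases hF : F = 0
  · simp [hF, absv_zero]
  by_cases hG : G = 0
  · simp [hG, absv_zero]
  rw [absv_of_ne_zero hF, absv_of_ne_zero hG, absv_of_ne_zero (mul_ne_zero hF hG),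
    HahnSeries.order_mul hF hG, neg_add, zpow_add₀ (by norm_num)]

theorem absv_one : absv (1 : LaurentSeries K) = 1 := by
  rw [absv_of_ne_zero one_ne_zero, HahnSeries.order_one]
  simp

theorem absv_inv (F : LaurentSeries K) : absv F⁻¹ = (absv F)⁻¹ := by
  by_cases hF : F = 0
  · simp [hF, absv_zero]
  · have h := absv_mul F F⁻¹
    rw [mul_inv_cancel₀ hF, absv_one] at h
    exact eq_inv_of_mul_eq_one_right h.symm

theorem absv_pow (F : LaurentSeries K) (n : ℕ) : absv (F ^ n) = absv F ^ n := by
  induction n with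
  | zero => simp [absv_one]
  | succ n ih => rw [pow_succ, absv_mul, ih, pow_succ]

theorem absv_neg (F : LaurentSeries K) : absv (-F) = absv F := by
  by_cases hF : F = 0
  · simp [hF]
  · rw [absv_of_ne_zero hF, absv_of_ne_zero (neg_ne_zero.mpr hF), HahnSeries.order_neg]

theorem absv_add_le_max (F G : LaurentSeries K) : absv (F + G) ≤ max (absv F) (absv G) := by
  by_cases hF : F = 0
  · simp [hF, absv_nonneg, absv_zero]
  by_cases hG : G = 0
  · simp [hG, absv_nonneg, absv_zero]
  have key : ∀ {A B : LaurentSeries K}, A ≠ 0 → absv B ≤ absv A → absv (A + B) ≤ absv A := by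
    intro A B hA hAB
    rw [absv_of_ne_zero hA] at hAB ⊢
    rw [absv_le_iff] at hAB ⊢
    intro h hh
    rw [HahnSeries.coeff_add, hAB h hh, HahnSeries.coeff_eq_zero_of_lt_order hh, add_zero]
  rcases le_total (absv G) (absv F) with h | h
  · exact (key hF h).trans (le_max_left _ _)
  · rw [add_comm]
    exact (key hG h).trans (le_max_right _ _)

theorem absv_add_le {F G : LaurentSeries K} {c : ℝ} (hF : absv F ≤ c) (hG : absv G ≤ c) :
    absv (F + G) ≤ c :=
  (absv_add_le_max F G).trans (max_le hF hG)

theorem absv_sub_le {F G : LaurentSeries K} {c : ℝ} (hF : absv F ≤ c) (hG : absv G ≤ c) :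
    absv (F - G) ≤ c := by
  rw [sub_eq_add_neg]
  exact absv_add_le hF (by rwa [absv_neg])

theorem absv_add_lt {F G : LaurentSeries K} {c : ℝ} (hF : absv F < c) (hG : absv G < c) :
    absv (F + G) < c :=
  (absv_add_le_max F G).trans_lt (max_lt hF hG)

theorem absv_sub_lt {F G : LaurentSeries K} {c : ℝ} (hF : absv F < c) (hG : absv G < c) :
    absv (F - G) < c := by
  rw [sub_eq_add_neg]
  exact absv_add_lt hF (by rwa [absv_neg])

/-- The larger of two terms dominates. -/
theorem absv_add_eq_of_lt {F G : LaurentSeries K} (h : absv G < absv F) :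
    absv (F + G) = absv F := by
  refine le_antisymm (absv_add_le le_rfl h.le) ?_
  by_contra! hlt
  have := absv_sub_lt hlt h
  simp at this

theorem absv_mul_le {F G : LaurentSeries K} {a b : ℝ} (hF : absv F ≤ a) (hG : absv G ≤ b) :
    absv (F * G) ≤ a * b := by
  rw [absv_mul]
  exact mul_le_mul hF hG (absv_nonneg _) ((absv_nonneg _).trans hF)

theorem eq_zero_of_forall_absv_le {F : LaurentSeries K}
    (h : ∀ n : ℕ, absv F ≤ (2 : ℝ) ^ (-(n : ℤ))) : F = 0 := by
  ext i
  refine absv_le_iff.mp (h (i.toNat + 1)) i ?_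
  have := Int.self_le_toNat i
  push_cast
  omega

theorem xElt_pow (n : ℕ) : xElt K ^ n = HahnSeries.single (-(n : ℤ)) (1 : K) := by
  rw [xElt, HahnSeries.single_pow]
  simp

theorem polyEmb_monomial (n : ℕ) (c : K) :
    polyEmb K (monomial n c) = HahnSeries.single (-(n : ℤ)) c := by
  simp only [polyEmb, coe_eval₂RingHom, eval₂_monomial, xElt_pow]
  rw [HahnSeries.C_apply, HahnSeries.single_mul_single]
  simp

theorem polyEmb_coeff_neg (P : K[X]) (n : ℕ) : (polyEmb K P).coeff (-(n : ℤ)) = P.coeff n := by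
  induction P using Polynomial.induction_on' with
  | add p q hp hq => rw [map_add, HahnSeries.coeff_add, hp, hq, Polynomial.coeff_add]
  | monomial m c =>
    rw [polyEmb_monomial, HahnSeries.coeff_single, Polynomial.coeff_monomial]
    simp [eq_comm]

theorem polyEmb_coeff_pos (P : K[X]) {h : ℤ} (hh : 0 < h) : (polyEmb K P).coeff h = 0 := by
  induction P using Polynomial.induction_on' with
  | add p q hp hq => rw [map_add, HahnSeries.coeff_add, hp, hq, add_zero]
  | monomial m c =>
    rw [polyEmb_monomial, HahnSeries.coeff_single]
    exact if_neg (by omega)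

theorem polyEmb_injective : Function.Injective (polyEmb K) := by
  intro P Q h
  ext n
  rw [← polyEmb_coeff_neg, h, polyEmb_coeff_neg]

theorem polyEmb_eq_zero {P : K[X]} : polyEmb K P = 0 ↔ P = 0 :=
  map_eq_zero_iff _ polyEmb_injective

theorem absv_polyEmb_le {P : K[X]} {n : ℕ} (h : P.natDegree ≤ n) :
    absv (polyEmb K P) ≤ (2 : ℝ) ^ n := by
  have : absv (polyEmb K P) ≤ (2 : ℝ) ^ (-(-(n : ℤ))) := by
    rw [absv_le_iff]
    intro i hi
    obtain ⟨m, rfl⟩ : ∃ m : ℕ, i = -(m : ℤ) := ⟨(-i).toNat, by omega⟩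
    rw [polyEmb_coeff_neg]
    exact Polynomial.coeff_eq_zero_of_natDegree_lt (by omega)
  simpa using this

theorem absv_polyEmb {P : K[X]} (hP : P ≠ 0) : absv (polyEmb K P) = (2 : ℝ) ^ P.natDegree := by
  refine le_antisymm (absv_polyEmb_le le_rfl) ?_
  by_contra! hlt
  rw [absv_of_ne_zero (polyEmb_eq_zero.not.mpr hP), ← zpow_natCast,
    zpow_lt_zpow_iff_right₀ (by norm_num : (1 : ℝ) < 2)] at hlt
  have := HahnSeries.coeff_eq_zero_of_lt_order (x := polyEmb K P) (i := -(P.natDegree : ℤ))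
    (by omega)
  rw [polyEmb_coeff_neg] at this
  exact hP (leadingCoeff_eq_zero.mp this)

theorem one_le_absv_polyEmb {P : K[X]} (hP : P ≠ 0) : 1 ≤ absv (polyEmb K P) := by
  rw [absv_polyEmb hP]
  exact one_le_pow₀ (by norm_num)

theorem eq_zero_of_absv_polyEmb_lt_one {P : K[X]} (h : absv (polyEmb K P) < 1) : P = 0 := by
  by_contra hP
  exact absurd (one_le_absv_polyEmb hP) (not_le.mpr h)

theorem fracNorm_nonneg (F : LaurentSeries K) : 0 ≤ fracNorm F := absv_nonneg _

/-- Subtracting a polynomial leaves the coefficients of positive index unchanged, so any explicit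
polynomial gives an upper bound. -/
theorem fracNorm_le (F : LaurentSeries K) (P : K[X]) :
    fracNorm F ≤ absv (F - polyEmb K P) := by
  by_cases h0 : F - polyEmb K P = 0
  · have : fracPart F = 0 := by
      rw [sub_eq_zero] at h0
      ext h
      simp only [fracPart, HahnSeries.coeff_zero, ite_eq_right_iff]
      intro hh
      rw [h0, polyEmb_coeff_pos P hh]
    rw [fracNorm, this, absv_zero]
    exact absv_nonneg _
  · have h1 := absv_of_ne_zero h0
    rw [h1, fracNorm, absv_le_iff]
    intro h hh
    simp only [fracPart, ite_eq_right_iff]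
    intro hpos
    have := absv_le_iff.mp h1.le h hh
    rwa [HahnSeries.coeff_sub, polyEmb_coeff_pos P hpos, sub_zero] at this

theorem exists_polyEmb_sub (F : LaurentSeries K) :
    ∃ P : K[X], F - polyEmb K P = fracPart F := by
  obtain ⟨N, hN⟩ : ∃ N : ℕ, ∀ h < -(N : ℤ), F.coeff h = 0 := by
    refine ⟨(-F.order).toNat, fun h hh => HahnSeries.coeff_eq_zero_of_lt_order ?_⟩
    have := Int.self_le_toNat (-F.order)
    omega
  refine ⟨∑ n ∈ Finset.range (N + 1), monomial n (F.coeff (-(n : ℤ))), ?_⟩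
  ext h
  rw [HahnSeries.coeff_sub]
  simp only [fracPart]
  split_ifs with hh
  · rw [polyEmb_coeff_pos _ hh, sub_zero]
  · obtain ⟨m, rfl⟩ : ∃ m : ℕ, h = -(m : ℤ) := ⟨(-h).toNat, by omega⟩
    rw [polyEmb_coeff_neg, Polynomial.finsetSum_coeff]
    simp only [Polynomial.coeff_monomial, Finset.sum_ite_eq', Finset.mem_range]
    split_ifs with hm
    · simp
    · rw [hN _ (by omega), sub_zero]

theorem fracNorm_lt_one (F : LaurentSeries K) : fracNorm F < 1 := by
  have : fracNorm F ≤ (2 : ℝ) ^ (-(1 : ℤ)) := by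
    rw [fracNorm, absv_le_iff]
    intro h hh
    simp only [fracPart]
    exact if_neg (by omega)
  refine this.trans_lt ?_
  norm_num

theorem exists_fracNorm_eq (F : LaurentSeries K) :
    ∃ P : K[X], fracNorm F = absv (F - polyEmb K P) := by
  obtain ⟨P, hP⟩ := exists_polyEmb_sub F
  exact ⟨P, by rw [hP, fracNorm]⟩

/-- A sequence with geometrically decreasing differences converges. -/
theorem exists_limit (c : ℕ → LaurentSeries K)
    (hc : ∀ n : ℕ, absv (c (n + 1) - c n) ≤ (2 : ℝ) ^ (-(2 * n + 1 : ℤ))) :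
    ∃ F, ∀ n : ℕ, absv (F - c n) ≤ (2 : ℝ) ^ (-(2 * n + 1 : ℤ)) := by
  have step : ∀ n d : ℕ, ∀ h : ℤ, h < 2 * n + 1 → (c (n + d)).coeff h = (c n).coeff h := by
    intro n d h hh
    induction d with
    | zero => rfl
    | succ d ih =>
      have := absv_le_iff.mp (hc (n + d)) h (by push_cast; omega)
      rw [HahnSeries.coeff_sub, sub_eq_zero] at this
      rw [← ih, ← this, add_assoc]
  -- The coefficient of index `h` is stable from stage `h.toNat` on, because `h < 2 * h.toNat + 1`.
  let f : ℤ → K := fun h => (c h.toNat).coeff h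
  have hf : ∀ n : ℕ, ∀ h : ℤ, h < 2 * n + 1 → f h = (c n).coeff h := by
    intro n h hh
    rcases le_total n h.toNat with hle | hle
    · obtain ⟨d, hd⟩ := Nat.exists_eq_add_of_le hle
      simp only [f]
      rw [hd]
      exact step n d h hh
    · obtain ⟨d, hd⟩ := Nat.exists_eq_add_of_le hle
      simp only [f]
      rw [hd]
      refine (step _ d h ?_).symm
      have := Int.self_le_toNat h
      omega
  have hsupp : ∃ N : ℤ, ∀ h < N, f h = 0 := by
    refine ⟨min 0 (c 0).order, fun h hh => ?_⟩
    rw [hf 0 h (by simp only [lt_min_iff] at hh; push_cast; omega)]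
    exact HahnSeries.coeff_eq_zero_of_lt_order (by simp only [lt_min_iff] at hh; omega)
  obtain ⟨N, hN⟩ := hsupp
  refine ⟨HahnSeries.ofSuppBddBelow f ⟨N, ?_⟩, ?_⟩
  · intro h hh
    by_contra! hlt
    exact hh (hN h hlt)
  · intro n
    rw [absv_le_iff]
    intro h hh
    rw [HahnSeries.coeff_sub, sub_eq_zero]
    exact hf n h hh

end Norm

/-! ### Continued fractions with linear partial quotients -/

section ContinuedFraction

variable {K : Type*} [Field K]

/-- The elementary matrix of a partial quotient. -/
def letterMat (a : K[X]) : Matrix (Fin 2) (Fin 2) K[X] := !![a, 1; 1, 0]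

/-- The product of the elementary matrices of a finite word of partial quotients. -/
def cfMat (l : List K[X]) : Matrix (Fin 2) (Fin 2) K[X] := (l.map letterMat).prod

theorem cfMat_nil : cfMat ([] : List K[X]) = 1 := rfl

theorem cfMat_singleton (x : K[X]) : cfMat [x] = letterMat x := by simp [cfMat]

theorem cfMat_append (l l' : List K[X]) : cfMat (l ++ l') = cfMat l * cfMat l' := by
  simp [cfMat]

theorem cfMat_replicate (n : ℕ) (x : K[X]) :
    cfMat (List.replicate n x) = letterMat x ^ n := by
  simp [cfMat]

theorem letterMat_transpose (a : K[X]) : (letterMat a).transpose = letterMat a := by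
  ext i j
  fin_cases i <;> fin_cases j <;> rfl

theorem cfMat_transpose (l : List K[X]) : (cfMat l).transpose = cfMat l.reverse := by
  rw [cfMat, Matrix.transpose_list_prod, cfMat, List.map_map, ← List.map_reverse]
  simp [Function.comp_def, letterMat_transpose]

theorem letterMat_det (a : K[X]) : (letterMat a).det = -1 := by
  simp [letterMat, Matrix.det_fin_two_of]

theorem cfMat_det (l : List K[X]) : (cfMat l).det = (-1) ^ l.length := by
  induction l with
  | nil => simp [cfMat_nil]
  | cons a l ih =>
    rw [← List.singleton_append, cfMat_append, Matrix.det_mul, ih, cfMat_singleton, letterMat_det]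
    simp [pow_add]

theorem mul_letterMat_zero (A : Matrix (Fin 2) (Fin 2) K[X]) (a : K[X]) (i : Fin 2) :
    (A * letterMat a) i 0 = A i 0 * a + A i 1 := by
  simp [letterMat, Matrix.mul_apply, Fin.sum_univ_two]

theorem mul_letterMat_one (A : Matrix (Fin 2) (Fin 2) K[X]) (a : K[X]) (i : Fin 2) :
    (A * letterMat a) i 1 = A i 0 := by
  simp [letterMat, Matrix.mul_apply, Fin.sum_univ_two]

/-- The matrix of the continuants of the first `n` partial quotients. -/
def contMat (ℓ : ℕ → K[X]) (n : ℕ) : Matrix (Fin 2) (Fin 2) K[X] :=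
  cfMat ((List.range n).map ℓ)

theorem contMat_zero (ℓ : ℕ → K[X]) : contMat ℓ 0 = 1 := rfl

theorem contMat_succ (ℓ : ℕ → K[X]) (n : ℕ) :
    contMat ℓ (n + 1) = contMat ℓ n * letterMat (ℓ n) := by
  rw [contMat, List.range_succ, List.map_append, cfMat_append]
  simp [contMat, cfMat_singleton]

theorem contMat_det (ℓ : ℕ → K[X]) (n : ℕ) : (contMat ℓ n).det = (-1) ^ n := by
  rw [contMat, cfMat_det]
  simp

theorem contMat_succ_one (ℓ : ℕ → K[X]) (n : ℕ) (i : Fin 2) :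
    contMat ℓ (n + 1) i 1 = contMat ℓ n i 0 := by
  rw [contMat_succ, mul_letterMat_one]

theorem contMat_degree {ℓ : ℕ → K[X]} (hℓ : ∀ n, (ℓ n).natDegree = 1) (n : ℕ) :
    (contMat ℓ n 0 0).degree = n ∧ (contMat ℓ n 0 1).degree < n := by
  induction n with
  | zero => simp [contMat_zero]
  | succ n ih =>
    have h1 : (ℓ n).degree = 1 := by
      exact (degree_eq_iff_natDegree_eq_of_pos one_pos).mpr (hℓ n)
    have h0 : (contMat ℓ n 0 0 * ℓ n).degree = ((n + 1 : ℕ) : WithBot ℕ) := by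
      rw [degree_mul, ih.1, h1]
      rfl
    constructor
    · rw [contMat_succ, mul_letterMat_zero, degree_add_eq_left_of_degree_lt, h0]
      rw [h0]
      exact ih.2.trans (by exact_mod_cast n.lt_succ_self)
    · rw [contMat_succ_one, ih.1]
      exact_mod_cast n.lt_succ_self

theorem contMat_ne_zero {ℓ : ℕ → K[X]} (hℓ : ∀ n, (ℓ n).natDegree = 1) (n : ℕ) :
    contMat ℓ n 0 0 ≠ 0 := by
  intro h
  have := (contMat_degree hℓ n).1
  simp [h] at this

theorem contMat_natDegree {ℓ : ℕ → K[X]} (hℓ : ∀ n, (ℓ n).natDegree = 1) (n : ℕ) :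
    (contMat ℓ n 0 0).natDegree = n :=
  natDegree_eq_of_degree_eq_some (contMat_degree hℓ n).1

theorem absv_contMat {ℓ : ℕ → K[X]} (hℓ : ∀ n, (ℓ n).natDegree = 1) (n : ℕ) :
    absv (polyEmb K (contMat ℓ n 0 0)) = (2 : ℝ) ^ n := by
  rw [absv_polyEmb (contMat_ne_zero hℓ n), contMat_natDegree hℓ n]

theorem contMat_entry_natDegree_le {ℓ : ℕ → K[X]} (hℓ : ∀ n, (ℓ n).natDegree = 1) (n : ℕ)
    (i j : Fin 2) : (contMat ℓ n i j).natDegree ≤ n := by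
  induction n generalizing j with
  | zero => fin_cases i <;> fin_cases j <;> simp [contMat_zero]
  | succ n ih =>
    fin_cases j
    · simp only [Fin.zero_eta, contMat_succ, mul_letterMat_zero]
      refine natDegree_add_le_of_degree_le (natDegree_mul_le.trans ?_) ((ih 1).trans n.le_succ)
      rw [hℓ]
      exact Nat.succ_le_succ (ih 0)
    · simp only [Fin.mk_one, contMat_succ_one]
      exact (ih 0).trans n.le_succ

/-- As `a 0 = 0`, its matrix is omitted from the product. It would only swap the rows, so
denominators sit in row 0 and numerators in row 1. -/
theorem contFrac_contsAux {a : ℕ → K[X]} (h0 : a 0 = 0) (n : ℕ) :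
    (contFrac a).contsAux n =
        ⟨polyEmb K (contMat (fun i => a (i + 1)) n 1 1),
          polyEmb K (contMat (fun i => a (i + 1)) n 0 1)⟩ ∧
      (contFrac a).contsAux (n + 1) =
        ⟨polyEmb K (contMat (fun i => a (i + 1)) n 1 0),
          polyEmb K (contMat (fun i => a (i + 1)) n 0 0)⟩ := by
  induction n with
  | zero =>
    constructor
    · simp [contMat_zero, GenContFract.contsAux]
    · simp [contMat_zero, GenContFract.contsAux, contFrac, h0]
  | succ n ih =>
    refine ⟨?_, ?_⟩
    · rw [ih.2, contMat_succ_one, contMat_succ_one]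
    · have hs : (contFrac a).s.get? n = some ⟨1, polyEmb K (a (n + 1))⟩ := rfl
      rw [GenContFract.contsAux_recurrence hs ih.1 ih.2]
      simp only [contMat_succ, mul_letterMat_zero, map_add, map_mul, one_mul]
      rw [mul_comm, mul_comm (polyEmb K (a (n + 1)))]

theorem contFrac_convs {a : ℕ → K[X]} (h0 : a 0 = 0) (n : ℕ) :
    (contFrac a).convs n = polyEmb K (contMat (fun i => a (i + 1)) n 1 0) /
      polyEmb K (contMat (fun i => a (i + 1)) n 0 0) := by
  rw [GenContFract.conv_eq_conts_a_div_conts_b, GenContFract.nth_cont_eq_succ_nth_contAux,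
    (contFrac_contsAux h0 n).2]

/-- Over the common denominator the numerator is a determinant `±1`; the denominators have degrees
`n` and `n + 1`. -/
theorem absv_conv_sub {ℓ : ℕ → K[X]} (hℓ : ∀ n, (ℓ n).natDegree = 1) (n : ℕ) :
    absv (polyEmb K (contMat ℓ (n + 1) 1 0) / polyEmb K (contMat ℓ (n + 1) 0 0) -
      polyEmb K (contMat ℓ n 1 0) / polyEmb K (contMat ℓ n 0 0)) =
      (2 : ℝ) ^ (-(2 * n + 1 : ℤ)) := by
  have hn := polyEmb_eq_zero.not.mpr (contMat_ne_zero hℓ n)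
  have hn' := polyEmb_eq_zero.not.mpr (contMat_ne_zero hℓ (n + 1))
  have hdet := contMat_det ℓ (n + 1)
  rw [Matrix.det_fin_two, contMat_succ_one, contMat_succ_one] at hdet
  rw [div_sub_div _ _ hn' hn, div_eq_mul_inv, absv_mul, absv_inv, absv_mul, absv_contMat hℓ,
    absv_contMat hℓ, ← map_mul, ← map_mul, ← map_sub, absv_cross_eq_one hdet]
  rw [one_mul, ← pow_add, zpow_neg, ← zpow_natCast]
  congr 2
  push_cast
  ring
where
  absv_cross_eq_one {n : ℕ} {A B C D : K[X]} (h : A * D - B * C = (-1) ^ n) :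
      absv (polyEmb K (C * B - A * D)) = 1 := by
    rw [show C * B - A * D = -(-1) ^ n by rw [← h]; ring, map_neg, absv_neg, map_pow, absv_pow,
      map_neg, absv_neg, map_one, absv_one, one_pow]

theorem exists_hasContFrac {a : ℕ → K[X]} (h0 : a 0 = 0)
    (ha : ∀ i, (a (i + 1)).natDegree = 1) : ∃ Θ, HasContFrac a Θ := by
  obtain ⟨Θ, hΘ⟩ := exists_limit (fun n => polyEmb K (contMat (fun i => a (i + 1)) n 1 0) /
      polyEmb K (contMat (fun i => a (i + 1)) n 0 0)) fun n => (absv_conv_sub ha n).le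
  refine ⟨Θ, ?_, ?_⟩
  · rintro (_ | i) hi
    · omega
    · exact (ha i).ge
  · simp only [contFrac_convs h0]
    refine squeeze_zero (fun _ => absv_nonneg _) (fun n => ?_)
      (tendsto_pow_atTop_nhds_zero_of_lt_one (r := (1 / 2 : ℝ)) (by norm_num) (by norm_num))
    refine (hΘ n).trans ?_
    rw [one_div, inv_pow, ← zpow_natCast, ← zpow_neg]
    exact zpow_le_zpow_right₀ (by norm_num) (by omega)

/-- The exact quality of approximation of a continued fraction with linear partial quotients. -/
theorem HasContFrac.absv_sub_conv {a : ℕ → K[X]} (h0 : a 0 = 0)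
    (ha : ∀ i, (a (i + 1)).natDegree = 1) {Θ : LaurentSeries K} (hΘ : HasContFrac a Θ) (n : ℕ) :
    absv (Θ - polyEmb K (contMat (fun i => a (i + 1)) n 1 0) /
      polyEmb K (contMat (fun i => a (i + 1)) n 0 0)) = (2 : ℝ) ^ (-(2 * n + 1 : ℤ)) := by
  have key := absv_conv_sub ha
  have hlim := hΘ.2
  simp only [contFrac_convs h0] at hlim
  generalize hc : (fun n => polyEmb K (contMat (fun i => a (i + 1)) n 1 0) /
      polyEmb K (contMat (fun i => a (i + 1)) n 0 0)) = c at hlim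
  have hc' : ∀ n, polyEmb K (contMat (fun i => a (i + 1)) n 1 0) /
      polyEmb K (contMat (fun i => a (i + 1)) n 0 0) = c n := fun n => congrFun hc n
  simp only [hc'] at key ⊢
  have hle : ∀ n : ℕ, absv (Θ - c n) ≤ (2 : ℝ) ^ (-(2 * n + 1 : ℤ)) := by
    intro n
    have hd : ∀ d, absv (c (n + d) - c n) ≤ (2 : ℝ) ^ (-(2 * n + 1 : ℤ)) := by
      intro d
      induction d with
      | zero =>
        rw [add_zero, sub_self, absv_zero]
        positivity
      | succ d ih =>
        rw [show c (n + (d + 1)) - c n = (c (n + d + 1) - c (n + d)) + (c (n + d) - c n) by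
          rw [add_assoc]; ring]
        refine absv_add_le ?_ ih
        rw [key]
        exact zpow_le_zpow_right₀ (by norm_num) (by push_cast; omega)
    have hev := hlim.eventually_lt_const (show (0 : ℝ) < 2 ^ (-(2 * n + 1 : ℤ)) by positivity)
    obtain ⟨N, hN, hNn⟩ := (hev.and (eventually_ge_atTop n)).exists
    obtain ⟨d, rfl⟩ := Nat.exists_eq_add_of_le hNn
    rw [show Θ - c n = (Θ - c (n + d)) + (c (n + d) - c n) by ring]
    exact absv_add_le ((hc' (n + d)) ▸ hN.le) (hd d)
  -- The first difference strictly dominates the remaining error, so the bound becomes an equality.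
  rw [show Θ - c n = (c (n + 1) - c n) + (Θ - c (n + 1)) by ring, absv_add_eq_of_lt, key]
  rw [key]
  refine (hle (n + 1)).trans_lt (zpow_lt_zpow_right₀ (by norm_num) ?_)
  push_cast
  omega

theorem HasContFrac.absv_eps {a : ℕ → K[X]} (h0 : a 0 = 0)
    (ha : ∀ i, (a (i + 1)).natDegree = 1) {Θ : LaurentSeries K} (hΘ : HasContFrac a Θ) (n : ℕ) :
    absv (polyEmb K (contMat (fun i => a (i + 1)) n 0 0) * Θ -
      polyEmb K (contMat (fun i => a (i + 1)) n 1 0)) = (2 : ℝ) ^ (-(n + 1 : ℤ)) := by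
  have hn := polyEmb_eq_zero.not.mpr (contMat_ne_zero (ℓ := fun i => a (i + 1)) ha n)
  have h := hΘ.absv_sub_conv h0 ha n
  have : polyEmb K (contMat (fun i => a (i + 1)) n 0 0) * Θ -
      polyEmb K (contMat (fun i => a (i + 1)) n 1 0) =
      polyEmb K (contMat (fun i => a (i + 1)) n 0 0) *
      (Θ - polyEmb K (contMat (fun i => a (i + 1)) n 1 0) /
      polyEmb K (contMat (fun i => a (i + 1)) n 0 0)) := by
    field_simp
  rw [this, absv_mul, h, absv_contMat ha, ← zpow_natCast, ← zpow_add₀ (by norm_num)]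
  congr 1
  ring

/-- `Θ` is approximated by the fractions read off from the continuant
matrices `contMat ℓ n` with the precision of a continued fraction with linear quotients. -/
structure Approx (ℓ : ℕ → K[X]) (Θ : LaurentSeries K) : Prop where
  natDegree_eq : ∀ n, (ℓ n).natDegree = 1
  absv_eq : ∀ n : ℕ, absv (polyEmb K (contMat ℓ n 0 0) * Θ - polyEmb K (contMat ℓ n 1 0)) =
    (2 : ℝ) ^ (-(n + 1 : ℤ))

theorem HasContFrac.approx {a : ℕ → K[X]} (h0 : a 0 = 0)
    (ha : ∀ i, (a (i + 1)).natDegree = 1) {Θ : LaurentSeries K} (hΘ : HasContFrac a Θ) :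
    Approx (fun i => a (i + 1)) Θ :=
  ⟨ha, hΘ.absv_eps h0 ha⟩

namespace Approx

variable {ℓ : ℕ → K[X]} {Θ : LaurentSeries K}

theorem absv_theta (h : Approx ℓ Θ) : absv Θ = 2⁻¹ := by
  have := h.absv_eq 0
  simpa [contMat_zero] using this

theorem ne_zero (h : Approx ℓ Θ) : Θ ≠ 0 := by
  rintro rfl
  have := h.absv_theta
  norm_num [absv_zero] at this

theorem absv_eps_le (h : Approx ℓ Θ) (n : ℕ) (j : Fin 2) :
    absv (polyEmb K (contMat ℓ n 0 j) * Θ - polyEmb K (contMat ℓ n 1 j)) ≤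
      (2 : ℝ) ^ (-(n : ℤ)) := by
  fin_cases j
  · simp only [Fin.zero_eta]
    rw [h.absv_eq]
    exact zpow_le_zpow_right₀ (by norm_num) (by omega)
  · simp only [Fin.mk_one]
    cases n with
    | zero => simp [contMat_zero, absv_neg, absv_one]
    | succ n =>
      rw [contMat_succ_one, contMat_succ_one, h.absv_eq]
      push_cast
      exact le_rfl

/-- The row vector `(Θ, -1)` is contracted by the continuant matrices. -/
theorem absv_row_le (h : Approx ℓ Θ) (n d : ℕ) (B : Matrix (Fin 2) (Fin 2) K[X])
    (hB : ∀ i j, (B i j).natDegree ≤ d) (j : Fin 2) :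
    absv (polyEmb K ((contMat ℓ n * B) 0 j) * Θ - polyEmb K ((contMat ℓ n * B) 1 j)) ≤
      (2 : ℝ) ^ ((d : ℤ) - n) := by
  have : polyEmb K ((contMat ℓ n * B) 0 j) * Θ - polyEmb K ((contMat ℓ n * B) 1 j) =
      polyEmb K (B 0 j) * (polyEmb K (contMat ℓ n 0 0) * Θ - polyEmb K (contMat ℓ n 1 0)) +
      polyEmb K (B 1 j) * (polyEmb K (contMat ℓ n 0 1) * Θ - polyEmb K (contMat ℓ n 1 1)) := by
    simp only [Matrix.mul_apply, Fin.sum_univ_two, map_add, map_mul]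
    ring
  rw [this, sub_eq_add_neg (d : ℤ), zpow_add₀ (by norm_num), zpow_natCast]
  exact absv_add_le (absv_mul_le (absv_polyEmb_le (hB 0 j)) (h.absv_eps_le n 0))
    (absv_mul_le (absv_polyEmb_le (hB 1 j)) (h.absv_eps_le n 1))

/-- A continued fraction with linear partial quotients is badly approximable. -/
theorem half_le (h : Approx ℓ Θ) {q : K[X]} (hq : q ≠ 0) (p : K[X]) :
    2⁻¹ ≤ absv (polyEmb K q) * absv (polyEmb K q * Θ - polyEmb K p) := by
  by_contra! hlt
  set n := q.natDegree with hn
  rw [absv_polyEmb hq] at hlt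
  have hp : (0 : ℝ) < 2 ^ n := by positivity
  have hsmall : absv (polyEmb K q * Θ - polyEmb K p) < (2 : ℝ) ^ (-(n + 1 : ℤ)) := by
    rw [neg_add, zpow_add₀ (by norm_num), zpow_neg, zpow_natCast, ← div_eq_inv_mul,
      lt_div_iff₀ hp, mul_comm, zpow_neg_one]
    exact hlt
  have hpos2 : (2 : ℝ) ^ n * (2 : ℝ) ^ (-(n + 1 : ℤ)) = 2⁻¹ := by
    rw [← zpow_natCast, ← zpow_add₀ (by norm_num)]
    norm_num
  -- A polynomial of norm less than 1 vanishes, so `p / q` equals the convergent whose denominator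
  -- has the same degree as `q`. Its error is known exactly and is too large.
  have hcross : contMat ℓ n 0 0 * p - q * contMat ℓ n 1 0 = 0 := by
    apply eq_zero_of_absv_polyEmb_lt_one
    have : polyEmb K (contMat ℓ n 0 0 * p - q * contMat ℓ n 1 0) =
        polyEmb K q * (polyEmb K (contMat ℓ n 0 0) * Θ - polyEmb K (contMat ℓ n 1 0)) -
        polyEmb K (contMat ℓ n 0 0) * (polyEmb K q * Θ - polyEmb K p) := by
      simp only [map_sub, map_mul]
      ring
    rw [this]
    refine absv_sub_lt ?_ ?_
    · rw [absv_mul, absv_polyEmb hq, h.absv_eq, ← hn, hpos2]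
      norm_num
    · rw [absv_mul, absv_contMat h.natDegree_eq]
      exact hlt.trans (by norm_num)
  have heq : polyEmb K (contMat ℓ n 0 0) * (polyEmb K q * Θ - polyEmb K p) =
      polyEmb K q * (polyEmb K (contMat ℓ n 0 0) * Θ - polyEmb K (contMat ℓ n 1 0)) := by
    have := congrArg (polyEmb K) hcross
    simp only [map_sub, map_mul, map_zero] at this
    linear_combination -this
  have habs := congrArg absv heq
  rw [absv_mul, absv_mul, absv_contMat h.natDegree_eq, absv_polyEmb hq, h.absv_eq, ← hn] at habs
  exact hsmall.ne (mul_left_cancel₀ hp.ne' habs)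

theorem isBad_of_forall {F : LaurentSeries K} {c : ℝ} (hc : 0 < c)
    (hF : ∀ q : K[X], q ≠ 0 → c ≤ absv (polyEmb K q) * fracNorm (polyEmb K q * F)) : IsBad F := by
  have : Nonempty {q : K[X] // q ≠ 0} := ⟨⟨1, one_ne_zero⟩⟩
  exact hc.trans_le (le_ciInf fun q => hF q.1 q.2)

theorem isBad (h : Approx ℓ Θ) : IsBad Θ := by
  refine isBad_of_forall (c := 2⁻¹) (by norm_num) fun q hq => ?_
  obtain ⟨p, hp⟩ := exists_fracNorm_eq (polyEmb K q * Θ)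
  rw [hp]
  exact h.half_le hq p

/-- If `p` is the polynomial part of `q Θ⁻¹`, then `|p| = 2 |q|` and `p Θ - q = -Θ (q Θ⁻¹ - p)`. The
factors `2` and `|Θ| = 1/2` cancel, so the constant for `Θ` is inherited. -/
theorem isBad_inv (h : Approx ℓ Θ) : IsBad Θ⁻¹ := by
  refine isBad_of_forall (c := 2⁻¹) (by norm_num) fun q hq => ?_
  obtain ⟨p, hp⟩ := exists_fracNorm_eq (polyEmb K q * Θ⁻¹)
  have hlt := fracNorm_lt_one (polyEmb K q * Θ⁻¹)
  rw [hp] at hlt ⊢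
  have hq1 := one_le_absv_polyEmb hq
  have hqΘ : absv (polyEmb K q * Θ⁻¹) = 2 * absv (polyEmb K q) := by
    rw [absv_mul, absv_inv, h.absv_theta, inv_inv, mul_comm]
  have hpabs : absv (polyEmb K p) = 2 * absv (polyEmb K q) := by
    rw [show polyEmb K p = polyEmb K q * Θ⁻¹ + -(polyEmb K q * Θ⁻¹ - polyEmb K p) by ring,
      absv_add_eq_of_lt, hqΘ]
    rw [absv_neg, hqΘ]
    linarith
  have hp0 : p ≠ 0 := by
    rintro rfl
    rw [map_zero, absv_zero] at hpabs
    linarith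
  have hmain := h.half_le hp0 q
  have : polyEmb K p * Θ - polyEmb K q = -(Θ * (polyEmb K q * Θ⁻¹ - polyEmb K p)) := by
    have := h.ne_zero
    field_simp
    ring
  rw [this, absv_neg, absv_mul, h.absv_theta, hpabs] at hmain
  linarith

/-- A symmetric matrix which starts with a continuant matrix yields a polynomial with good
approximations of both `Θ` and `Θ⁻¹`. -/
theorem exists_littlewood_le (h : Approx ℓ Θ) (n d : ℕ) (hd : d + 1 < n)
    (B : Matrix (Fin 2) (Fin 2) K[X]) (hB : ∀ i j, (B i j).natDegree ≤ d)
    (hdet : (contMat ℓ n * B) 0 0 ≠ 0) (hsymm : (contMat ℓ n * B).IsSymm) :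
    ∃ q : K[X], q ≠ 0 ∧
      absv (polyEmb K q) * fracNorm (polyEmb K q * Θ) * fracNorm (polyEmb K q * Θ⁻¹) ≤
        (2 : ℝ) ^ (3 * (d : ℤ) - n + 1) := by
  set M := contMat ℓ n * B with hM
  have hs : M 0 1 = M 1 0 := hsymm.apply 1 0
  have hM0 := h.absv_row_le n d B hB 0
  have hM1 := h.absv_row_le n d B hB 1
  rw [← hM] at hM0 hM1
  -- Column 0 compares `M 1 0` with `M 0 0 * Θ`. By symmetry `M 1 0` is also the coefficient of `Θ`
  -- in column 1. Thus it works for `Θ⁻¹` and for `Θ` at once.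
  refine ⟨M 1 0, ?_, ?_⟩
  -- Were `M 1 0` zero, column 0 would give `|M 0 0| / 2 ≤ 1/4`, which is where `d + 1 < n` enters.
  · intro h0
    rw [h0, map_zero, sub_zero, absv_mul, h.absv_theta] at hM0
    have := one_le_absv_polyEmb hdet
    have h2 : (2 : ℝ) ^ ((d : ℤ) - n) ≤ 2 ^ (-2 : ℤ) :=
      zpow_le_zpow_right₀ (by norm_num) (by omega)
    norm_num at h2
    linarith
  · have e1 : absv (polyEmb K (M 1 0)) ≤ (2 : ℝ) ^ (n + d) := by
      apply absv_polyEmb_le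
      rw [hM, Matrix.mul_apply, Fin.sum_univ_two]
      have := contMat_entry_natDegree_le h.natDegree_eq n
      exact natDegree_add_le_of_degree_le
        (natDegree_mul_le.trans (add_le_add (this _ _) (hB _ _)))
        (natDegree_mul_le.trans (add_le_add (this _ _) (hB _ _)))
    have e2 : fracNorm (polyEmb K (M 1 0) * Θ) ≤ (2 : ℝ) ^ ((d : ℤ) - n) := by
      rw [hs] at hM1
      exact (fracNorm_le _ _).trans hM1
    have e3 : fracNorm (polyEmb K (M 1 0) * Θ⁻¹) ≤ (2 : ℝ) ^ ((d : ℤ) - n) * 2 := by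
      refine (fracNorm_le _ (M 0 0)).trans ?_
      have : polyEmb K (M 1 0) * Θ⁻¹ - polyEmb K (M 0 0) =
          -((polyEmb K (M 0 0) * Θ - polyEmb K (M 1 0)) * Θ⁻¹) := by
        have := h.ne_zero
        field_simp
        ring
      rw [this, absv_neg]
      refine absv_mul_le hM0 ?_
      rw [absv_inv, h.absv_theta, inv_inv]
    refine (mul_le_mul (mul_le_mul e1 e2 (fracNorm_nonneg _) (by positivity)) e3
      (fracNorm_nonneg _) (by positivity)).trans (le_of_eq ?_)
    rw [← zpow_natCast, ← zpow_add₀ (by norm_num), ← mul_assoc, ← zpow_add₀ (by norm_num),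
      ← zpow_add_one₀ (by norm_num)]
    congr 1
    push_cast
    ring

/-- A symmetric matrix which starts with a continuant matrix and has a short remainder is
annihilated by the trace form of any quadratic equation of `Θ`. -/
theorem trace_eq_zero (h : Approx ℓ Θ) {a b c : K[X]}
    (hquad : polyEmb K a + polyEmb K b * Θ + polyEmb K c * Θ ^ 2 = 0) {e : ℕ}
    (hb : b.natDegree ≤ e) (hc : c.natDegree ≤ e) (n d : ℕ) (hde : d + e < n)
    (B : Matrix (Fin 2) (Fin 2) K[X]) (hB : ∀ i j, (B i j).natDegree ≤ d)
    (hsymm : (contMat ℓ n * B).IsSymm) :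
    a * (contMat ℓ n * B) 0 0 + b * (contMat ℓ n * B) 0 1 + c * (contMat ℓ n * B) 1 1 = 0 := by
  have hs := hsymm.apply 1 0
  have hM0 := h.absv_row_le n d B hB 0
  have hM1 := h.absv_row_le n d B hB 1
  set M := contMat ℓ n * B
  apply eq_zero_of_absv_polyEmb_lt_one
  -- Modulo the quadratic equation, the trace is a combination of the two column errors with
  -- coefficients of norm at most `2 ^ e`, hence a polynomial of norm less than 1.
  have : polyEmb K (a * M 0 0 + b * M 0 1 + c * M 1 1) =
      -((polyEmb K b + polyEmb K c * Θ) * (polyEmb K (M 0 0) * Θ - polyEmb K (M 1 0)) +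
        polyEmb K c * (polyEmb K (M 0 1) * Θ - polyEmb K (M 1 1))) := by
    rw [hs]
    simp only [map_add, map_mul]
    linear_combination polyEmb K (M 0 0) * hquad
  rw [this, absv_neg]
  have hbc : absv (polyEmb K b + polyEmb K c * Θ) ≤ (2 : ℝ) ^ e := by
    refine absv_add_le (absv_polyEmb_le hb) ?_
    rw [← mul_one ((2 : ℝ) ^ e)]
    refine absv_mul_le (absv_polyEmb_le hc) ?_
    rw [h.absv_theta]
    norm_num
  refine (absv_add_le (absv_mul_le hbc hM0) (absv_mul_le (absv_polyEmb_le hc) hM1)).trans_lt ?_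
  rw [← zpow_natCast, ← zpow_add₀ (by norm_num)]
  exact zpow_lt_one_of_neg₀ (by norm_num) (by omega)

end Approx

end ContinuedFraction

/-! ### Infinite concatenation of nonempty words -/

section Words

theorem flatMap_range_prefix {A : Type*} (w : ℕ → List A) {m n : ℕ} (h : m ≤ n) :
    (List.range m).flatMap w <+: (List.range n).flatMap w := by
  obtain ⟨d, rfl⟩ := Nat.exists_eq_add_of_le h
  rw [List.range_add, List.flatMap_append]
  exact List.prefix_append _ _

theorem flatMap_range_succ {A : Type*} (w : ℕ → List A) (n : ℕ) :
    (List.range (n + 1)).flatMap w = (List.range n).flatMap w ++ w n := by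
  rw [List.range_succ, List.flatMap_append, List.flatMap_singleton]

theorem le_length_flatMap_range {A : Type*} {w : ℕ → List A} (hw : ∀ n, w n ≠ []) (n : ℕ) :
    n ≤ ((List.range n).flatMap w).length := by
  induction n with
  | zero => simp
  | succ n ih =>
    rw [flatMap_range_succ, List.length_append]
    have := List.length_pos_iff.mpr (hw n)
    omega

/-- Since no word is empty, the first `i + 1` words contain at least `i + 1` letters, and the
default value `0` is never read. -/
theorem infiniteConcat_eq_getElem {A : Type*} [Zero A] {w : ℕ → List A} (hw : ∀ n, w n ≠ [])
    (i : ℕ) : infiniteConcat w i =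
      ((List.range (i + 1)).flatMap w)[i]'(le_length_flatMap_range hw (i + 1)) := by
  rw [infiniteConcat, List.getD_eq_getElem]

theorem map_infiniteConcat_of_prefix {A : Type*} [Zero A] {w : ℕ → List A} (hw : ∀ n, w n ≠ [])
    {l : List A} {N : ℕ} (hl : l <+: (List.range N).flatMap w) :
    (List.range l.length).map (infiniteConcat w) = l := by
  refine List.ext_getElem (by simp) fun i h1 h2 => ?_
  rw [List.getElem_map, List.getElem_range, infiniteConcat_eq_getElem hw,
    (flatMap_range_prefix w (le_max_left (i + 1) N)).getElem,
    (hl.trans (flatMap_range_prefix w (le_max_right (i + 1) N))).getElem]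

theorem infiniteConcat_mem {A : Type*} [Zero A] {w : ℕ → List A} (hw : ∀ n, w n ≠ []) (i : ℕ) :
    ∃ n, infiniteConcat w i ∈ w n := by
  rw [infiniteConcat_eq_getElem hw]
  obtain ⟨n, -, hn⟩ := List.mem_flatMap.mp
    (List.getElem_mem (le_length_flatMap_range hw (i + 1)))
  exact ⟨n, hn⟩

end Words

/-! ### The word of partial quotients of `Θ(k)` -/

/-- The letter `±X` which is repeated in the block of index `n`. -/
def midLetter (n : ℕ) : (ZMod 3)[X] := (-1) ^ n * X

/-- The first and last letter of the block of index `n`. -/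
def endLetter (n : ℕ) : (ZMod 3)[X] := (-1) ^ n * X + 1

theorem midLetter_add_two (n : ℕ) : midLetter (n + 2) = midLetter n := by
  simp [midLetter, pow_add]

theorem endLetter_add_two (n : ℕ) : endLetter (n + 2) = endLetter n := by
  simp [endLetter, pow_add]

/-- The block `H_n((-1) ^ n X)`. -/
def block (k n : ℕ) : List (ZMod 3)[X] :=
  [endLetter n] ++ List.replicate (u k n) (midLetter n) ++ [endLetter n]

theorem block_eq (k n : ℕ) : (H k n).map (fun P => P.comp ((-1) ^ n * X)) = block k n := by
  simp [H, block, midLetter, endLetter]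

theorem block_ne_nil (k n : ℕ) : block k n ≠ [] := by simp [block]

/-- The word formed by the first `n` blocks. -/
def initWord (k n : ℕ) : List (ZMod 3)[X] := (List.range n).flatMap (block k)

theorem initWord_zero (k : ℕ) : initWord k 0 = [] := rfl

theorem initWord_succ (k n : ℕ) : initWord k (n + 1) = initWord k n ++ block k n :=
  flatMap_range_succ _ _

/-- The partial quotients of positive index. -/
def letter (k : ℕ) : ℕ → (ZMod 3)[X] := infiniteConcat (block k)

theorem partialQuotient_succ (k i : ℕ) : partialQuotient k (i + 1) = letter k i := by
  simp only [partialQuotient, letter, block_eq]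

theorem letter_natDegree (k i : ℕ) : (letter k i).natDegree = 1 := by
  obtain ⟨n, hn⟩ := infiniteConcat_mem (block_ne_nil k) i
  change letter k i ∈ _ at hn
  have h1 : ((-1) ^ n * X : (ZMod 3)[X]).natDegree = 1 := by
    rcases neg_one_pow_eq_or (ZMod 3)[X] n with h | h <;> simp [h]
  have h2 : ((-1) ^ n * X + 1 : (ZMod 3)[X]).natDegree = 1 := by
    rw [natDegree_add_eq_left_of_natDegree_lt (by rw [h1]; simp), h1]
  simp only [block, List.mem_append, List.mem_singleton, List.mem_replicate] at hn
  rcases hn with (hn | ⟨-, hn⟩) | hn <;> rw [hn] <;> assumption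

theorem contMat_of_prefix {k N : ℕ} {l : List (ZMod 3)[X]} (hl : l <+: initWord k N) :
    contMat (letter k) l.length = cfMat l := by
  rw [contMat, letter, map_infiniteConcat_of_prefix (block_ne_nil k) hl]

/-- The value is a choice made by `Classical.epsilon`, legitimate because the convergents have a
limit. -/
theorem Theta_hasContFrac (k : ℕ) : HasContFrac (partialQuotient k) (Theta k) :=
  Classical.epsilon_spec (exists_hasContFrac rfl fun i => by
    rw [partialQuotient_succ, letter_natDegree])

theorem Theta_approx (k : ℕ) : Approx (letter k) (Theta k) := by
  have h := (Theta_hasContFrac k).approx rfl fun i => by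
    rw [partialQuotient_succ, letter_natDegree]
  simp only [partialQuotient_succ] at h
  exact h

theorem u_add_two (k n : ℕ) : u k n + 2 = (k + 2) * 3 ^ n := by
  have : 1 ≤ 3 ^ n := Nat.one_le_pow _ _ (by norm_num)
  have : (k + 2) * 1 ≤ (k + 2) * 3 ^ n := Nat.mul_le_mul_left _ this
  unfold u
  omega

theorem u_succ (k n : ℕ) : u k (n + 1) = 3 * u k n + 4 := by
  have h1 := u_add_two k n
  have h2 := u_add_two k (n + 1)
  rw [pow_succ, ← mul_assoc, ← h1] at h2
  omega

theorem two_mul_le_u (k n : ℕ) : 2 * n ≤ u k n := by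
  induction n with
  | zero => simp
  | succ n ih =>
    rw [u_succ]
    omega

/-- All earlier blocks together are about half as long as the run in block `n`. -/
theorem initWord_length (k n : ℕ) : 2 * (initWord k n).length = u k n - k := by
  induction n with
  | zero => simp [initWord_zero, u]
  | succ n ih =>
    have : k ≤ u k n := by
      clear ih
      induction n with
      | zero => simp [u]
      | succ n ih =>
        rw [u_succ]
        omega
    rw [initWord_succ, List.length_append, mul_add, ih, u_succ]
    simp only [block, List.length_append, List.length_singleton, List.length_replicate]
    omega

theorem cfMat_transpose_natDegree_le {k N : ℕ} {l : List (ZMod 3)[X]} (hl : l <+: initWord k N)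
    (i j : Fin 2) : ((cfMat l).transpose i j).natDegree ≤ l.length := by
  rw [← contMat_of_prefix hl]
  exact contMat_entry_natDegree_le (letter_natDegree k) _ _ _

/-- A prefix of the word of partial quotients which ends inside a run of `±X`. -/
theorem run_prefix {k t j : ℕ} (hj : j ≤ u k t) :
    initWord k t ++ [endLetter t] ++ List.replicate j (midLetter t) <+: initWord k (t + 1) := by
  obtain ⟨d, hd⟩ := Nat.exists_eq_add_of_le hj
  rw [initWord_succ, block, hd, List.replicate_add]
  simp only [List.append_assoc, List.prefix_append_right_inj]
  exact List.prefix_append _ _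

/-- The entry is a sum of two products of denominators, and the first has the larger degree, so
nothing cancels. -/
theorem contMat_mul_transpose_ne_zero {K : Type*} [Field K] {ℓ : ℕ → K[X]}
    (hℓ : ∀ n, (ℓ n).natDegree = 1) (n j : ℕ) :
    (contMat ℓ n * (contMat ℓ j).transpose) 0 0 ≠ 0 := by
  intro h
  rw [Matrix.mul_apply, Fin.sum_univ_two, Matrix.transpose_apply, Matrix.transpose_apply] at h
  have hn := contMat_degree hℓ n
  have hj := contMat_degree hℓ j
  have h0 : contMat ℓ n 0 0 * contMat ℓ j 0 0 ≠ 0 :=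
    mul_ne_zero (contMat_ne_zero hℓ n) (contMat_ne_zero hℓ j)
  have hlt : (contMat ℓ n 0 1 * contMat ℓ j 0 1).degree <
      (contMat ℓ n 0 0 * contMat ℓ j 0 0).degree := by
    by_cases hz : contMat ℓ n 0 1 = 0
    · rw [hz, zero_mul, degree_zero, bot_lt_iff_ne_bot, ne_eq, degree_eq_bot]
      exact h0
    · rw [degree_mul, degree_mul, hn.1, hj.1]
      refine (add_le_add_left hn.2.le _).trans_lt ?_
      exact WithBot.add_lt_add_left (by simp) hj.2
  have := degree_add_eq_left_of_degree_lt hlt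
  rw [h, degree_zero, eq_comm, degree_eq_bot] at this
  exact h0 this

/-! ### The Littlewood property and distinctness of the series -/

theorem littlewood_of_forall {K : Type*} [Field K] {F G : LaurentSeries K}
    (h : ∀ s : ℕ, ∃ q : K[X], q ≠ 0 ∧
      absv (polyEmb K q) * fracNorm (polyEmb K q * F) * fracNorm (polyEmb K q * G) ≤
        (1 / 2 : ℝ) ^ s) : Littlewood F G := by
  have hnn : ∀ q : {q : K[X] // q ≠ 0},
      0 ≤ absv (polyEmb K q) * fracNorm (polyEmb K q * F) * fracNorm (polyEmb K q * G) :=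
    fun q => mul_nonneg (mul_nonneg (absv_nonneg _) (fracNorm_nonneg _)) (fracNorm_nonneg _)
  refine le_antisymm ?_ (Real.iInf_nonneg hnn)
  refine ge_of_tendsto' (tendsto_pow_atTop_nhds_zero_of_lt_one (r := (1 / 2 : ℝ)) (by norm_num)
    (by norm_num)) fun s => ?_
  obtain ⟨q, hq, hle⟩ := h s
  exact (ciInf_le ⟨0, by rintro _ ⟨q, rfl⟩; exact hnn q⟩ ⟨q, hq⟩).trans hle

theorem Theta_littlewood (k : ℕ) : Littlewood (Theta k) (Theta k)⁻¹ := by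
  refine littlewood_of_forall fun s => ?_
  have hw : initWord k s ++ [endLetter s] <+: initWord k (s + 1) := by
    simpa using run_prefix (k := k) (t := s) (j := 0) (Nat.zero_le _)
  set w := initWord k s ++ [endLetter s] with hwdef
  -- The palindrome is centred at block `s + 1`. It takes the run of block `s` on the left and an
  -- equally long start of the run of block `s + 2` on the right; the two blocks use the same
  -- letters because signs have period 2.
  set v := List.replicate (u k s) (midLetter s) ++ [endLetter s] ++ (block k (s + 1) ++
    ([endLetter s] ++ List.replicate (u k s) (midLetter s))) with hvdef
  have hwv : w ++ v <+: initWord k (s + 3) := by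
    have := run_prefix (k := k) (t := s + 2) (j := u k s) (by rw [u_succ, u_succ]; omega)
    rw [midLetter_add_two, endLetter_add_two, initWord_succ, initWord_succ] at this
    convert this using 1
    simp [hwdef, hvdef, block]
  have hpal : v.reverse = v := by
    simp [hvdef, block]
  have hmul : contMat (letter k) (w ++ v).length * (cfMat w).transpose =
      cfMat (w ++ v ++ w.reverse) := by
    rw [contMat_of_prefix hwv, cfMat_transpose, cfMat_append (w ++ v)]
  have hlen : w.length + 5 * u k s + 8 = (w ++ v).length := by
    simp only [hvdef, block, List.length_append, List.length_replicate, List.length_singleton,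
      u_succ]
    omega
  have hwlen : 2 * w.length ≤ u k s + 2 := by
    have := initWord_length k s
    simp only [hwdef, List.length_append, List.length_singleton]
    omega
  obtain ⟨q, hq, hle⟩ := (Theta_approx k).exists_littlewood_le (w ++ v).length w.length
    (by omega) (cfMat w).transpose (cfMat_transpose_natDegree_le hw)
    (by rw [← contMat_of_prefix hw]
        exact contMat_mul_transpose_ne_zero (letter_natDegree k) _ _)
    (by rw [hmul, Matrix.IsSymm, cfMat_transpose]
        simp [hpal])
  refine ⟨q, hq, hle.trans ?_⟩
  rw [one_div, inv_pow, ← zpow_natCast, ← zpow_neg]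
  -- With `d = w.length` and `n = d + 5 * u k s + 8`, the exponent `3 * d - n + 1` is at most `-4 *
  -- u k s - 5`.
  refine zpow_le_zpow_right₀ (by norm_num) ?_
  have := two_mul_le_u k s
  omega

/-- For `k < k'` the words agree on `X + 1, X, …, X` with `k` letters `X`, then continue with `X +
1` and `X` respectively. If the values were equal, subtracting the two next errors would recover the
error at the common prefix, which is too large to be such a difference. -/
theorem Theta_injective : Function.Injective Theta := by
  have key : ∀ k k' : ℕ, k < k' → Theta k ≠ Theta k' := by
    intro k k' hlt heq
    have hu : ∀ k, u k 0 = k := by simp [u]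
    have hp : [endLetter 0] ++ List.replicate k (midLetter 0) ++ [endLetter 0] <+:
        initWord k 1 := by
      simp [initWord_succ, initWord_zero, block, hu]
    have hp' : [endLetter 0] ++ List.replicate k (midLetter 0) ++ [midLetter 0] <+:
        initWord k' 1 := by
      have := run_prefix (k := k') (t := 0) (j := k + 1) (by rw [hu]; omega)
      rw [List.replicate_succ'] at this
      simpa [initWord_zero] using this
    have h1 := (Theta_approx k).absv_eq
      ([endLetter 0] ++ List.replicate k (midLetter 0) ++ [endLetter 0]).length
    have h2 := (Theta_approx k').absv_eq
      ([endLetter 0] ++ List.replicate k (midLetter 0) ++ [midLetter 0]).length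
    have h3 := (Theta_approx k).absv_eq
      ([endLetter 0] ++ List.replicate k (midLetter 0)).length
    rw [contMat_of_prefix hp] at h1
    rw [contMat_of_prefix hp', ← heq] at h2
    rw [contMat_of_prefix ((List.prefix_append _ _).trans hp)] at h3
    rw [cfMat_append _ [endLetter 0], cfMat_singleton, mul_letterMat_zero,
      mul_letterMat_zero] at h1
    rw [cfMat_append _ [midLetter 0], cfMat_singleton, mul_letterMat_zero,
      mul_letterMat_zero] at h2
    set A := cfMat ([endLetter 0] ++ List.replicate k (midLetter 0))
    have hdiff : polyEmb (ZMod 3) (A 0 0) * Theta k - polyEmb (ZMod 3) (A 1 0) =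
        (polyEmb (ZMod 3) (A 0 0 * endLetter 0 + A 0 1) * Theta k -
          polyEmb (ZMod 3) (A 1 0 * endLetter 0 + A 1 1)) -
        (polyEmb (ZMod 3) (A 0 0 * midLetter 0 + A 0 1) * Theta k -
          polyEmb (ZMod 3) (A 1 0 * midLetter 0 + A 1 1)) := by
      have he : endLetter 0 = midLetter 0 + 1 := rfl
      rw [he]
      simp only [map_add, map_mul, map_one]
      ring
    have hle := absv_sub_le h1.le (h2.le.trans_eq (by simp))
    rw [← hdiff, h3, zpow_le_zpow_iff_right₀ (by norm_num : (1 : ℝ) < 2)] at hle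
    simp only [List.length_append, List.length_singleton, List.length_replicate] at hle
    omega
  intro k k' h
  rcases lt_trichotomy k k' with hlt | hlt | hlt
  · exact absurd h (key _ _ hlt)
  · exact hlt
  · exact absurd h.symm (key _ _ hlt)

/-! ### Absence of equations of degree at most two -/

section Quadratic

variable {R : Type*} [CommRing R]

/-- The trace form `N ↦ tr (L N)` on symmetric matrices, where `L` is the matrix of the binary
quadratic form with coefficients `a, b, c`. -/
def traceForm (a b c : R) (M : Matrix (Fin 2) (Fin 2) R) : R :=
  a * M 0 0 + b * M 0 1 + c * M 1 1

theorem traceForm_add (a b c : R) (M N : Matrix (Fin 2) (Fin 2) R) :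
    traceForm a b c (M + N) = traceForm a b c M + traceForm a b c N := by
  simp only [traceForm, Matrix.add_apply]
  ring

theorem traceForm_smul (a b c r : R) (M : Matrix (Fin 2) (Fin 2) R) :
    traceForm a b c (r • M) = r * traceForm a b c M := by
  simp only [traceForm, Matrix.smul_apply, smul_eq_mul]
  ring

/-- By cyclicity of the trace, conjugating the argument amounts to substituting `A` in the quadratic
form. -/
theorem traceForm_conj (a b c : R) (A : Matrix (Fin 2) (Fin 2) R) :
    ∃ a' b' c' : R, ∀ N : Matrix (Fin 2) (Fin 2) R, N.IsSymm →
      traceForm a b c (A * N * A.transpose) = traceForm a' b' c' N := by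
  refine ⟨a * A 0 0 ^ 2 + b * (A 0 0 * A 1 0) + c * A 1 0 ^ 2,
    2 * a * (A 0 0 * A 0 1) + b * (A 0 0 * A 1 1 + A 0 1 * A 1 0) + 2 * c * (A 1 0 * A 1 1),
    a * A 0 1 ^ 2 + b * (A 0 1 * A 1 1) + c * A 1 1 ^ 2, fun N hN => ?_⟩
  have hs : N 1 0 = N 0 1 := hN.apply 0 1
  simp only [traceForm, Matrix.mul_apply, Fin.sum_univ_two, Matrix.transpose_apply, hs]
  ring

/-- Up to sign the adjugate inverts `A`, so every symmetric matrix has the form `A * N *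
A.transpose`. -/
theorem eq_zero_of_traceForm_conj {a b c : R} {A : Matrix (Fin 2) (Fin 2) R}
    (hA : A.det ^ 2 = 1)
    (h : ∀ N : Matrix (Fin 2) (Fin 2) R, N.IsSymm →
      traceForm a b c (A * N * A.transpose) = 0) : a = 0 ∧ b = 0 ∧ c = 0 := by
  have key : ∀ E : Matrix (Fin 2) (Fin 2) R, E.IsSymm → traceForm a b c E = 0 := by
    intro E hE
    have h1 := h (A.adjugate * E * A.adjugate.transpose)
      (by rw [Matrix.IsSymm]; simp [Matrix.transpose_mul, hE.eq, Matrix.mul_assoc])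
    have h2 : A * (A.adjugate * E * A.adjugate.transpose) * A.transpose = E := by
      rw [← Matrix.mul_assoc, ← Matrix.mul_assoc, Matrix.mul_adjugate, Matrix.mul_assoc,
        ← Matrix.transpose_mul, Matrix.mul_adjugate, Matrix.transpose_smul, Matrix.transpose_one]
      simp [smul_smul, ← pow_two, hA]
    rwa [h2] at h1
  have ha := key !![1, 0; 0, 0] (by ext i j; fin_cases i <;> fin_cases j <;> rfl)
  have hb := key !![0, 1; 1, 0] (by ext i j; fin_cases i <;> fin_cases j <;> rfl)
  have hc := key !![0, 0; 0, 1] (by ext i j; fin_cases i <;> fin_cases j <;> rfl)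
  simp [traceForm] at ha hb hc
  exact ⟨ha, hb, hc⟩

end Quadratic

theorem letterMat_sq {K : Type*} [Field K] (x : K[X]) :
    letterMat x ^ 2 = x • letterMat x + 1 := by
  rw [pow_two]
  ext i j
  fin_cases i <;> fin_cases j <;> simp [letterMat]

theorem letterMat_pow_isSymm {K : Type*} [Field K] (x : K[X]) (n : ℕ) :
    (letterMat x ^ n).IsSymm := by
  rw [Matrix.IsSymm, Matrix.transpose_pow, letterMat_transpose]

theorem three_eq_zero : (3 : (ZMod 3)[X]) = 0 := CharP.cast_eq_zero (ZMod 3)[X] 3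

/-- A quadratic equation for `Θ(k)` makes the trace form vanish along all powers, once a long run
of letters `±X` follows. -/
theorem traceForm_run_eq_zero {k : ℕ} {a b c : (ZMod 3)[X]}
    (h : polyEmb (ZMod 3) a + polyEmb (ZMod 3) b * Theta k +
      polyEmb (ZMod 3) c * Theta k ^ 2 = 0) {e : ℕ} (hb : b.natDegree ≤ e)
    (hc : c.natDegree ≤ e) {t : ℕ} (ht : e + 1 ≤ t) (j : ℕ) (hj : j ≤ e + 2) :
    traceForm a b c (cfMat (initWord k t ++ [endLetter t]) * letterMat (midLetter t) ^ j *
      (cfMat (initWord k t ++ [endLetter t])).transpose) = 0 := by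
  set w := initWord k t ++ [endLetter t] with hw
  have hu := two_mul_le_u k t
  have hpre : w <+: initWord k (t + 1) := by
    simpa using run_prefix (k := k) (t := t) (j := 0) (Nat.zero_le _)
  -- The continuant has length `w.length + j` and the correction `(cfMat w).transpose` has degree at
  -- most `w.length`, so `j > e` is exactly what `trace_eq_zero` needs.
  have hlarge : ∀ j, e < j → j ≤ u k t → traceForm a b c
      (cfMat w * letterMat (midLetter t) ^ j * (cfMat w).transpose) = 0 := by
    intro j hj1 hj2
    have hpre' := run_prefix (k := k) (t := t) hj2
    rw [← hw] at hpre'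
    have hM : contMat (letter k) (w ++ List.replicate j (midLetter t)).length =
        cfMat w * letterMat (midLetter t) ^ j := by
      rw [contMat_of_prefix hpre', cfMat_append, cfMat_replicate]
    have := (Theta_approx k).trace_eq_zero h hb hc
      (w ++ List.replicate j (midLetter t)).length w.length
      (by simp only [List.length_append, List.length_replicate]; omega) (cfMat w).transpose
      (cfMat_transpose_natDegree_le hpre) (by
        rw [hM, Matrix.IsSymm, Matrix.transpose_mul, Matrix.transpose_mul,
          (letterMat_pow_isSymm _ _).eq, Matrix.transpose_transpose, Matrix.mul_assoc])
    rwa [hM] at this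
  have hrec : ∀ j, traceForm a b c
      (cfMat w * letterMat (midLetter t) ^ (j + 2) * (cfMat w).transpose) =
      midLetter t * traceForm a b c
        (cfMat w * letterMat (midLetter t) ^ (j + 1) * (cfMat w).transpose) +
      traceForm a b c (cfMat w * letterMat (midLetter t) ^ j * (cfMat w).transpose) := by
    intro j
    rw [pow_add, letterMat_sq, ← traceForm_smul, ← traceForm_add, mul_add, mul_one,
      mul_smul_comm, ← pow_succ, mul_add, mul_smul_comm, add_mul, smul_mul_assoc]
  -- In the recurrence the term of lowest index has coefficient 1, so it can be run backwards from
  -- the exponents `e + 1` and `e + 2`.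
  have hdown : ∀ i, i ≤ e + 1 → traceForm a b c
      (cfMat w * letterMat (midLetter t) ^ (e + 1 - i) * (cfMat w).transpose) = 0 ∧
      traceForm a b c
      (cfMat w * letterMat (midLetter t) ^ (e + 1 - i + 1) * (cfMat w).transpose) = 0 := by
    intro i hi
    induction i with
    | zero => exact ⟨hlarge _ (by omega) (by omega), hlarge _ (by omega) (by omega)⟩
    | succ i ih =>
      obtain ⟨h1, h2⟩ := ih (by omega)
      have hr := hrec (e + 1 - (i + 1))
      rw [show e + 1 - (i + 1) + 2 = e + 1 - i + 1 by omega,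
        show e + 1 - (i + 1) + 1 = e + 1 - i by omega, h1, h2, mul_zero, zero_add] at hr
      rw [show e + 1 - (i + 1) + 1 = e + 1 - i by omega]
      exact ⟨hr.symm, h1⟩
  rcases Nat.lt_or_ge e j with hlt | hge
  · exact hlarge j hlt (by omega)
  · have := (hdown (e + 1 - j) (by omega)).1
    rwa [show e + 1 - (e + 1 - j) = j by omega] at this

/-- This form vanishes on `1` and `letterMat X`, whose span is stable under the conjugation. It can
therefore only be multiplied by a factor, here `-1`. -/
theorem traceForm_letterMat_conj (N : Matrix (Fin 2) (Fin 2) (ZMod 3)[X]) (hN : N.IsSymm) :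
    traceForm 1 (-X) (-1) (letterMat X * N * letterMat X) = -traceForm 1 (-X) (-1) N := by
  rw [Matrix.eta_fin_two N, show N 1 0 = N 0 1 from hN.apply 0 1]
  simp [traceForm, letterMat]
  ring

theorem traceForm_pow_conj (N : Matrix (Fin 2) (Fin 2) (ZMod 3)[X]) (hN : N.IsSymm) (n : ℕ) :
    traceForm 1 (-X) (-1) (letterMat X ^ n * N * letterMat X ^ n) =
      (-1) ^ n * traceForm 1 (-X) (-1) N := by
  induction n with
  | zero => simp
  | succ n ih =>
    have hs : (letterMat X ^ n * N * letterMat X ^ n).IsSymm := by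
      rw [Matrix.IsSymm, Matrix.transpose_mul, Matrix.transpose_mul,
        (letterMat_pow_isSymm _ _).eq, hN.eq, Matrix.mul_assoc]
    have := traceForm_letterMat_conj _ hs
    have hJ : letterMat X ^ (n + 1) * N * letterMat X ^ (n + 1) =
        letterMat X * (letterMat X ^ n * N * letterMat X ^ n) * letterMat X := by
      calc _ = (letterMat X * letterMat X ^ n) * N * (letterMat X ^ n * letterMat X) := by
            rw [← pow_succ', ← pow_succ]
        _ = _ := by simp only [mul_assoc]
    rw [hJ, this, ih, pow_succ, mul_neg_one, neg_mul]

theorem traceForm_junction_ne_zero :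
    traceForm 1 (-X) (-1) (letterMat (X + 1 : (ZMod 3)[X]) * letterMat (-X + 1) *
      (letterMat (X + 1) * letterMat (-X + 1)).transpose) ≠ 0 := by
  have : traceForm 1 (-X) (-1) (letterMat (X + 1 : (ZMod 3)[X]) * letterMat (-X + 1) *
      (letterMat (X + 1) * letterMat (-X + 1)).transpose) = X ^ 3 + X := by
    simp [traceForm, letterMat, Matrix.mul_apply, Fin.sum_univ_two]
    linear_combination (-X ^ 2 + 1) * three_eq_zero
  rw [this]
  intro h
  have := congrArg (fun p => coeff p 3) h
  simp [coeff_X] at this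

/-- `Θ(k)` satisfies no nontrivial equation of degree at most two. -/
theorem Theta_not_quadratic {k : ℕ} {a b c : (ZMod 3)[X]}
    (h : polyEmb (ZMod 3) a + polyEmb (ZMod 3) b * Theta k +
      polyEmb (ZMod 3) c * Theta k ^ 2 = 0) : a = 0 ∧ b = 0 ∧ c = 0 := by
  set e := max b.natDegree c.natDegree
  have hb : b.natDegree ≤ e := le_max_left _ _
  have hc : c.natDegree ≤ e := le_max_right _ _
  -- An even index large enough for `traceForm_run_eq_zero`: block `t` then uses `X` and the next
  -- one `-X`.
  set t := 2 * (e + 1) with ht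
  have hmid : midLetter t = X := by simp [midLetter, ht, pow_mul]
  have hend : endLetter t = X + 1 := by simp [endLetter, ht, pow_mul]
  have hend' : endLetter (t + 1) = -X + 1 := by simp [endLetter, ht, pow_mul, pow_succ]
  have h0 := traceForm_run_eq_zero h hb hc (t := t) (by omega) 0 (by omega)
  have h1 := traceForm_run_eq_zero h hb hc (t := t) (by omega) 1 (by omega)
  have h2 := traceForm_run_eq_zero h hb hc (t := t + 1) (by omega) 0 (by omega)
  have hsplit : cfMat (initWord k (t + 1) ++ [endLetter (t + 1)]) =
      cfMat (initWord k t ++ [endLetter t]) *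
      (letterMat X ^ u k t * (letterMat (X + 1) * letterMat (-X + 1))) := by
    rw [initWord_succ, block, hend, hend', hmid]
    simp only [cfMat_append, cfMat_singleton, cfMat_replicate, mul_assoc]
  have hdet : (cfMat (initWord k t ++ [endLetter t])).det ^ 2 = 1 := by
    rw [cfMat_det, ← pow_mul, mul_comm, pow_mul]
    simp
  rw [hsplit] at h2
  rw [hmid] at h0 h1
  set A := cfMat (initWord k t ++ [endLetter t])
  set Z := letterMat (X + 1 : (ZMod 3)[X]) * letterMat (-X + 1) with hZ
  obtain ⟨a', b', c', hconj⟩ := traceForm_conj a b c A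
  rw [pow_zero, hconj _ Matrix.isSymm_one] at h0
  rw [hconj _ (letterMat_pow_isSymm _ _), pow_one] at h1
  have hZs : (Z * Z.transpose).IsSymm := by
    rw [Matrix.IsSymm, Matrix.transpose_mul, Matrix.transpose_transpose]
  have hNs : (letterMat X ^ u k t * (Z * Z.transpose) * letterMat X ^ u k t).IsSymm := by
    rw [Matrix.IsSymm, Matrix.transpose_mul, Matrix.transpose_mul,
      (letterMat_pow_isSymm _ _).eq, hZs.eq]
    simp only [Matrix.mul_assoc]
  have h2' : traceForm a' b' c'
      (letterMat X ^ u k t * (Z * Z.transpose) * letterMat X ^ u k t) = 0 := by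
    rw [pow_zero, mul_one, Matrix.transpose_mul, Matrix.transpose_mul,
      (letterMat_pow_isSymm _ _).eq] at h2
    rw [← hconj _ hNs]
    simp only [Matrix.mul_assoc] at h2 ⊢
    exact h2
  -- Vanishing on `1` and `letterMat X` leaves only multiples of the form `1, -X, -1`. The junction
  -- `Z` with the next run will kill the multiple.
  have hc' : c' = -a' := by
    simp [traceForm] at h0
    linear_combination h0
  have hb' : b' = -(a' * X) := by
    simp [traceForm, letterMat] at h1
    linear_combination h1
  have hprop : ∀ N, traceForm a' b' c' N = a' * traceForm 1 (-X) (-1) N := by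
    intro N
    simp only [traceForm, hb', hc']
    ring
  rw [hprop, traceForm_pow_conj _ hZs] at h2'
  have ha' : a' = 0 := by
    rcases mul_eq_zero.mp h2' with h | h
    · exact h
    · rcases mul_eq_zero.mp h with h | h
      · exact absurd h (pow_ne_zero _ (neg_ne_zero.mpr one_ne_zero))
      · exact absurd h traceForm_junction_ne_zero
  refine eq_zero_of_traceForm_conj hdet fun N hN => ?_
  rw [hconj N hN, hprop, ha', zero_mul]

/-! ### The quartic equation from the Frobenius map -/

section QuarticRelation

local notation "M₃" => Matrix (Fin 2) (Fin 2) (ZMod 3)[X]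

/-- The matrix which intertwines `letterMat (X ^ 3)` and `letterMat X ^ 3`. -/
def intertwiner : M₃ := !![X, 1; 1, -X]

/-- In characteristic 3 both matrices have trace `X ^ 3` and determinant `-1`, so an intertwiner
exists over the fraction field; this one is linear in `X`. -/
theorem intertwiner_mul :
    intertwiner * letterMat (X ^ 3) = letterMat X ^ 3 * intertwiner := by
  have hJ : letterMat X ^ 3 = (!![X ^ 3 - X, X ^ 2 + 1; X ^ 2 + 1, X] : M₃) := by
    rw [pow_succ, letterMat_sq, add_mul, one_mul, smul_mul_assoc]
    ext1 i j
    fin_cases i <;> fin_cases j <;> simp [letterMat]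
    · linear_combination (X : (ZMod 3)[X]) * three_eq_zero
    · ring
    · ring
  rw [hJ]
  ext1 i j
  fin_cases i <;> fin_cases j <;> simp [letterMat, intertwiner]
  · ring
  · linear_combination (X : (ZMod 3)[X]) * three_eq_zero
  · linear_combination (-X : (ZMod 3)[X]) * three_eq_zero
  · ring

theorem intertwiner_mul_pow (n : ℕ) :
    intertwiner * letterMat (X ^ 3) ^ n = letterMat X ^ (3 * n) * intertwiner := by
  induction n with
  | zero => simp
  | succ n ih =>
    rw [pow_succ, ← mul_assoc, ih, mul_assoc, intertwiner_mul, ← mul_assoc, ← pow_add]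
    rfl

/-- The Frobenius map on matrices of polynomials. -/
def frobMat : M₃ →+* M₃ := (frobenius (ZMod 3)[X] 3).mapMatrix

theorem frobMat_apply (A : M₃) (i j : Fin 2) : frobMat A i j = A i j ^ 3 := rfl

theorem frobMat_letterMat : frobMat (letterMat X) = letterMat (X ^ 3) := by
  ext i j
  fin_cases i <;> fin_cases j <;> simp [frobMat_apply, letterMat]

/-- The matrix of the block of index `n` in terms of powers of the matrix of `X`. -/
def blockMat (n e : ℕ) : M₃ :=
  if Even n then !![1, 1; 0, 1] * letterMat X ^ e * !![1, 0; 1, 1]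
  else !![1, -1; 0, -1] * letterMat X ^ e * !![1, 0; -1, -1]

/-- For even `n`, the end letter's matrix is that of `X` times a constant unipotent matrix, on
either side. The two end letters thus raise the exponent from `u k n` to `u k n + 2 = (k + 2) * 3 ^
n`, which triples exactly. For odd `n`, conjugation by `diag(1, -1)` turns `-X` into `X` at the cost
of signs. -/
theorem cfMat_block (k n : ℕ) : cfMat (block k n) = blockMat n ((k + 2) * 3 ^ n) ∨
    cfMat (block k n) = -blockMat n ((k + 2) * 3 ^ n) := by
  rw [← u_add_two, block, cfMat_append, cfMat_append, cfMat_replicate, cfMat_singleton]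
  rcases Nat.even_or_odd n with hn | hn
  · left
    have h1 : letterMat (endLetter n) = !![1, 1; 0, 1] * letterMat X := by
      ext i j
      fin_cases i <;> fin_cases j <;> simp [letterMat, endLetter, hn.neg_one_pow]
    have h2 : letterMat (endLetter n) = letterMat X * !![1, 0; 1, 1] := by
      ext i j
      fin_cases i <;> fin_cases j <;> simp [letterMat, endLetter, hn.neg_one_pow]
    nth_rewrite 2 [h2]
    rw [h1, blockMat, if_pos hn, midLetter, hn.neg_one_pow, one_mul, pow_succ, pow_succ']
    simp only [mul_assoc]
  · have h1 : letterMat (endLetter n) = -(!![1, -1; 0, -1] * letterMat X * !![1, 0; 0, -1]) := by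
      ext i j
      fin_cases i <;> fin_cases j <;> simp [letterMat, endLetter, hn.neg_one_pow]
      ring
    have h2 : letterMat (endLetter n) = -(!![1, 0; 0, -1] * letterMat X * !![1, 0; -1, -1]) := by
      ext i j
      fin_cases i <;> fin_cases j <;> simp [letterMat, endLetter, hn.neg_one_pow]
      ring
    have h3 : ∀ e, !![1, 0; 0, -1] * letterMat (midLetter n) ^ e * !![1, 0; 0, -1] =
        (-1) ^ e * letterMat X ^ e := by
      have hDD : (!![1, 0; 0, -1] : M₃) * !![1, 0; 0, -1] = 1 := by
        ext i j
        fin_cases i <;> fin_cases j <;> simp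
      have hD : letterMat (midLetter n) =
          -(!![1, 0; 0, -1] * letterMat X * !![1, 0; 0, -1]) := by
        ext i j
        fin_cases i <;> fin_cases j <;> simp [letterMat, midLetter, hn.neg_one_pow]
      intro e
      induction e with
      | zero => simp [hDD]
      | succ e ih =>
        rw [pow_succ, pow_succ (-1 : M₃), pow_succ (letterMat X)]
        nth_rewrite 2 [hD]
        calc _ = -((!![1, 0; 0, -1] * letterMat (midLetter n) ^ e * !![1, 0; 0, -1]) *
              letterMat X * (!![1, 0; 0, -1] * !![1, 0; 0, -1])) := by noncomm_ring
          _ = _ := by rw [ih, hDD]; noncomm_ring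
    have h4 : letterMat (endLetter n) * letterMat (midLetter n) ^ u k n *
        letterMat (endLetter n) = (-1) ^ u k n * blockMat n (u k n + 2) := by
      nth_rewrite 2 [h2]
      rw [h1, blockMat, if_neg (Nat.not_even_iff_odd.mpr hn), pow_succ, pow_succ']
      calc _ = !![1, -1; 0, -1] * letterMat X *
            (!![1, 0; 0, -1] * letterMat (midLetter n) ^ u k n * !![1, 0; 0, -1]) *
            letterMat X * !![1, 0; -1, -1] := by noncomm_ring
        _ = _ := by
          rw [h3]
          rcases neg_one_pow_eq_or M₃ (u k n) with h | h <;> rw [h] <;> noncomm_ring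
    rw [h4]
    rcases neg_one_pow_eq_or M₃ (u k n) with h | h
    · left
      rw [h, one_mul]
    · right
      rw [h, neg_one_mul]

/-- The matrix relating the cube of a complete quotient to a later complete quotient. -/
def transfer (n : ℕ) : M₃ :=
  if Even n then !![X - 1, -1; -1, X + 1] else !![X + 1, 1; 1, X - 1]

theorem frobMat_blockMat (n e : ℕ) : frobMat (blockMat n e) =
    if Even n then !![1, 1; 0, 1] * letterMat (X ^ 3) ^ e * !![1, 0; 1, 1]
    else !![1, -1; 0, -1] * letterMat (X ^ 3) ^ e * !![1, 0; -1, -1] := by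
  have h (x y z t : ZMod 3) : frobMat !![C x, C y; C z, C t] = !![C x, C y; C z, C t] := by
    ext1 i j
    fin_cases i <;> fin_cases j <;>
      simp [frobMat_apply, ← C_pow, ZMod.pow_card]
  have h1 := h 1 1 0 1
  have h2 := h 1 0 1 1
  have h3 := h 1 (-1) 0 (-1)
  have h4 := h 1 0 (-1) (-1)
  simp only [C_1, C_0, C_neg] at h1 h2 h3 h4
  unfold blockMat
  split_ifs <;> simp only [map_mul, map_pow, frobMat_letterMat, h1, h2, h3, h4]

/-- The transfer matrices are chosen so that passing the constant outer factor of a block turns each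
of them into `intertwiner`, which then passes through the power of `letterMat X`. -/
theorem blockMat_succ_mul_transfer (n e : ℕ) :
    blockMat (n + 1) (3 * e) * transfer (n + 1) = transfer n * frobMat (blockMat n e) := by
  rw [frobMat_blockMat]
  rcases Nat.even_or_odd n with hn | hn
  · have hn' : ¬ Even (n + 1) := Nat.not_even_iff_odd.mpr hn.add_one
    rw [blockMat, transfer, transfer, if_neg hn', if_neg hn', if_pos hn, if_pos hn]
    have h1 : (!![X - 1, -1; -1, X + 1] : M₃) * !![1, 1; 0, 1] =
        !![1, -1; 0, -1] * intertwiner := by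
      ext1 i j
      fin_cases i <;> fin_cases j <;> simp [intertwiner]
      · ring
      · linear_combination -three_eq_zero
    have h2 : (!![1, 0; -1, -1] : M₃) * !![X + 1, 1; 1, X - 1] =
        intertwiner * !![1, 0; 1, 1] := by
      ext1 i j
      fin_cases i <;> fin_cases j <;> simp [intertwiner]
      · linear_combination -three_eq_zero
      · ring
    calc _ = !![1, -1; 0, -1] * letterMat X ^ (3 * e) *
          (!![1, 0; -1, -1] * !![X + 1, 1; 1, X - 1]) := by simp only [mul_assoc]
      _ = !![1, -1; 0, -1] * (letterMat X ^ (3 * e) * intertwiner) * !![1, 0; 1, 1] := by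
        rw [h2]; simp only [mul_assoc]
      _ = (!![X - 1, -1; -1, X + 1] * !![1, 1; 0, 1]) * letterMat (X ^ 3) ^ e *
          !![1, 0; 1, 1] := by rw [h1, ← intertwiner_mul_pow]; simp only [mul_assoc]
      _ = _ := by simp only [mul_assoc]
  · have hn' : Even (n + 1) := hn.add_one
    have hn0 : ¬ Even n := Nat.not_even_iff_odd.mpr hn
    rw [blockMat, transfer, transfer, if_pos hn', if_pos hn', if_neg hn0, if_neg hn0]
    have h1 : (!![X + 1, 1; 1, X - 1] : M₃) * !![1, -1; 0, -1] =
        !![1, 1; 0, 1] * intertwiner := by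
      ext1 i j
      fin_cases i <;> fin_cases j <;> simp [intertwiner]
      · linear_combination -three_eq_zero
      · ring
    have h2 : (!![1, 0; 1, 1] : M₃) * !![X - 1, -1; -1, X + 1] =
        intertwiner * !![1, 0; -1, -1] := by
      ext1 i j
      fin_cases i <;> fin_cases j <;> simp [intertwiner]
      · ring
      · linear_combination -three_eq_zero
    calc _ = !![1, 1; 0, 1] * letterMat X ^ (3 * e) *
          (!![1, 0; 1, 1] * !![X - 1, -1; -1, X + 1]) := by simp only [mul_assoc]
      _ = !![1, 1; 0, 1] * (letterMat X ^ (3 * e) * intertwiner) * !![1, 0; -1, -1] := by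
        rw [h2]; simp only [mul_assoc]
      _ = (!![X + 1, 1; 1, X - 1] * !![1, -1; 0, -1]) * letterMat (X ^ 3) ^ e *
          !![1, 0; -1, -1] := by rw [h1, ← intertwiner_mul_pow]; simp only [mul_assoc]
      _ = _ := by simp only [mul_assoc]

theorem cfMat_block_succ_mul_transfer (k n : ℕ) :
    cfMat (block k (n + 1)) * transfer (n + 1) = transfer n * frobMat (cfMat (block k n)) ∨
    cfMat (block k (n + 1)) * transfer (n + 1) = -(transfer n * frobMat (cfMat (block k n))) := by
  have h := blockMat_succ_mul_transfer n ((k + 2) * 3 ^ n)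
  rw [show 3 * ((k + 2) * 3 ^ n) = (k + 2) * 3 ^ (n + 1) by ring] at h
  rcases cfMat_block k n with h1 | h1 <;> rcases cfMat_block k (n + 1) with h2 | h2 <;>
    rw [h1, h2] <;> simp [h]

/-- The matrix of the equation of `Θ(k)`. -/
def equationMat (k : ℕ) : M₃ := cfMat (block k 0) * transfer 0

/-- The transfer matrices telescope along the blocks. The sign does not matter, as only norms of
errors are used. -/
theorem cfMat_initWord_mul_transfer (k n : ℕ) :
    cfMat (initWord k (n + 1)) * transfer n = equationMat k * frobMat (cfMat (initWord k n)) ∨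
    cfMat (initWord k (n + 1)) * transfer n =
      -(equationMat k * frobMat (cfMat (initWord k n))) := by
  induction n with
  | zero => simp [initWord_succ, initWord_zero, cfMat_nil, equationMat]
  | succ n ih =>
    have : cfMat (initWord k (n + 1 + 1)) * transfer (n + 1) =
        cfMat (initWord k (n + 1)) * (cfMat (block k (n + 1)) * transfer (n + 1)) := by
      rw [initWord_succ k (n + 1), cfMat_append, mul_assoc]
    rw [this]
    have hB : cfMat (initWord k (n + 1)) = cfMat (initWord k n) * cfMat (block k n) := by
      rw [initWord_succ, cfMat_append]
    have hE : equationMat k * frobMat (cfMat (initWord k (n + 1))) =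
        equationMat k * frobMat (cfMat (initWord k n)) * frobMat (cfMat (block k n)) := by
      rw [hB, map_mul, mul_assoc]
    rw [hE]
    rcases cfMat_block_succ_mul_transfer k n with h1 | h1 <;> rcases ih with h2 | h2 <;>
      rw [h1] <;> simp only [mul_neg, ← mul_assoc, h2] <;> simp

theorem transfer_natDegree_le (n : ℕ) (i j : Fin 2) : (transfer n i j).natDegree ≤ 1 := by
  unfold transfer
  split_ifs <;> fin_cases i <;> fin_cases j <;> simp <;> compute_degree

theorem Theta_quartic_relation (k : ℕ) :
    polyEmb (ZMod 3) (-equationMat k 1 0) + polyEmb (ZMod 3) (equationMat k 0 0) * Theta k +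
      polyEmb (ZMod 3) (-equationMat k 1 1) * Theta k ^ 3 +
      polyEmb (ZMod 3) (equationMat k 0 1) * Theta k ^ 4 = 0 := by
  have hA := Theta_approx k
  set Θ := Theta k
  set N := equationMat k
  obtain ⟨d, hd⟩ : ∃ d, ∀ i j, (N i j).natDegree ≤ d :=
    ⟨∑ i, ∑ j, (N i j).natDegree, fun i j =>
      (Finset.single_le_sum (f := fun j => (N i j).natDegree) (fun _ _ => Nat.zero_le _)
        (Finset.mem_univ j)).trans
      (Finset.single_le_sum (f := fun i => ∑ j, (N i j).natDegree) (fun _ _ => Nat.zero_le _)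
        (Finset.mem_univ i))⟩
  set F := polyEmb (ZMod 3) (-N 1 0) + polyEmb (ZMod 3) (N 0 0) * Θ +
      polyEmb (ZMod 3) (-N 1 1) * Θ ^ 3 + polyEmb (ZMod 3) (N 0 1) * Θ ^ 4 with hF
  -- The bound does not depend on `n`, which forces `F = 0`.
  have hsmall : ∀ n : ℕ, (2 : ℝ) ^ (3 * n) * absv F ≤ 2 ^ (d + 1) := by
    intro n
    have hle := le_length_flatMap_range (block_ne_nil k) n
    change n ≤ (initWord k n).length at hle
    have hq := absv_contMat hA.natDegree_eq (initWord k n).length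
    have heps := hA.absv_eps_le (initWord k n).length 0
    have hrow := hA.absv_row_le (initWord k (n + 1)).length 1 (transfer n)
      (transfer_natDegree_le n) 0
    rw [contMat_of_prefix (List.prefix_rfl (l := initWord k n))] at hq heps
    rw [contMat_of_prefix (List.prefix_rfl (l := initWord k (n + 1)))] at hrow
    have hfrob := cfMat_initWord_mul_transfer k n
    set T := cfMat (initWord k (n + 1)) * transfer n
    set E := cfMat (initWord k n)
    set q := polyEmb (ZMod 3) (E 0 0)
    set p := polyEmb (ZMod 3) (E 1 0)
    set r := polyEmb (ZMod 3) (T 0 0) * Θ - polyEmb (ZMod 3) (T 1 0)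
    have hr : absv r ≤ 2 ^ (d + 1) := by
      refine hrow.trans ?_
      rw [← zpow_natCast]
      exact zpow_le_zpow_right₀ (by norm_num) (by push_cast; omega)
    have hcube : (q * Θ - p) ^ 3 = q ^ 3 * Θ ^ 3 - p ^ 3 := by
      have h3 : (3 : LaurentSeries (ZMod 3)) = 0 := by
        rw [← map_ofNat (polyEmb (ZMod 3)) 3, three_eq_zero, map_zero]
      linear_combination (-q ^ 2 * Θ ^ 2 * p + q * Θ * p ^ 2) * h3
    -- Replacing `p ^ 3` by `q ^ 3 * Θ ^ 3` costs `(q * Θ - p) ^ 3`, by additivity of cubing; what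
    -- remains is `q ^ 3 * F`. The left side is, up to sign, the bounded error `r` of the longer
    -- word.
    have hprod : polyEmb (ZMod 3) ((N * frobMat E) 0 0) * Θ -
        polyEmb (ZMod 3) ((N * frobMat E) 1 0) = q ^ 3 * F -
        (polyEmb (ZMod 3) (N 0 1) * Θ - polyEmb (ZMod 3) (N 1 1)) * (q * Θ - p) ^ 3 := by
      rw [hcube, hF]
      simp only [Matrix.mul_apply, Fin.sum_univ_two, frobMat_apply, map_add, map_mul, map_pow,
        map_neg]
      ring
    have hr' : absv (polyEmb (ZMod 3) ((N * frobMat E) 0 0) * Θ -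
        polyEmb (ZMod 3) ((N * frobMat E) 1 0)) = absv r := by
      rcases hfrob with h | h
      · rw [← h]
      · rw [← absv_neg]
        congr 1
        simp only [r, h, Matrix.neg_apply, map_neg]
        ring
    have heq : q ^ 3 * F = (polyEmb (ZMod 3) ((N * frobMat E) 0 0) * Θ -
        polyEmb (ZMod 3) ((N * frobMat E) 1 0)) +
        (polyEmb (ZMod 3) (N 0 1) * Θ - polyEmb (ZMod 3) (N 1 1)) * (q * Θ - p) ^ 3 := by
      rw [hprod]
      ring
    have hN : absv (polyEmb (ZMod 3) (N 0 1) * Θ - polyEmb (ZMod 3) (N 1 1)) ≤ 2 ^ (d + 1) := by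
      have hmono : (2 : ℝ) ^ d ≤ 2 ^ (d + 1) := pow_le_pow_right₀ (by norm_num) d.le_succ
      refine absv_sub_le ?_ ((absv_polyEmb_le (hd 1 1)).trans hmono)
      rw [absv_mul, hA.absv_theta]
      have := absv_polyEmb_le (hd 0 1)
      linarith [absv_nonneg (polyEmb (ZMod 3) (N 0 1))]
    have heps1 : absv ((q * Θ - p) ^ 3) ≤ 1 := by
      rw [absv_pow]
      refine pow_le_one₀ (absv_nonneg _) (heps.trans ?_)
      exact zpow_le_one_of_nonpos₀ (by norm_num) (by omega)
    have htot : absv (q ^ 3 * F) ≤ 2 ^ (d + 1) := by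
      rw [heq]
      refine absv_add_le (hr'.le.trans hr) ?_
      simpa using absv_mul_le hN heps1
    rw [absv_mul, absv_pow, hq, ← pow_mul] at htot
    refine (mul_le_mul_of_nonneg_right ?_ (absv_nonneg _)).trans htot
    exact pow_le_pow_right₀ (by norm_num) (by omega)
  refine eq_zero_of_forall_absv_le fun n => ?_
  have h := hsmall (n + d + 1)
  have hp : (0 : ℝ) < 2 ^ n := by positivity
  rw [zpow_neg, zpow_natCast, ← one_div, le_div_iff₀ hp]
  have hpd : (0 : ℝ) < 2 ^ (d + 1) := by positivity
  refine le_of_mul_le_mul_left ?_ hpd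
  rw [mul_one]
  refine le_trans ?_ h
  rw [mul_comm (absv F), ← mul_assoc, ← pow_add]
  exact mul_le_mul_of_nonneg_right (pow_le_pow_right₀ (by norm_num) (by omega)) (absv_nonneg _)

/-- The equation of `Θ(k)` has no projective root modulo `X`. -/
theorem equationMat_no_root (k : ℕ) (s t : ZMod 3)
    (h : (-equationMat k 1 0).eval 0 * t ^ 4 + (equationMat k 0 0).eval 0 * s * t ^ 3 +
      (-equationMat k 1 1).eval 0 * s ^ 3 * t + (equationMat k 0 1).eval 0 * s ^ 4 = 0) :
    s = 0 ∧ t = 0 := by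
  let ev : M₃ →+* Matrix (Fin 2) (Fin 2) (ZMod 3) := (evalRingHom 0).mapMatrix
  have hev : ∀ A i j, (A i j).eval 0 = ev A i j := fun A i j => rfl
  have hJ : ev (letterMat X) = !![0, 1; 1, 0] := by
    ext1 i j
    fin_cases i <;> fin_cases j <;> simp [ev, letterMat]
  have hU : ev !![1, 1; 0, 1] = !![1, 1; 0, 1] := by
    ext1 i j
    fin_cases i <;> fin_cases j <;> simp [ev]
  have hL : ev !![1, 0; 1, 1] = !![1, 0; 1, 1] := by
    ext1 i j
    fin_cases i <;> fin_cases j <;> simp [ev]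
  have hT : ev (transfer 0) = !![-1, -1; -1, 1] := by
    ext1 i j
    fin_cases i <;> fin_cases j <;> simp [ev, transfer]
  have hpow : ∀ n : ℕ, (!![0, 1; 1, 0] : Matrix (Fin 2) (Fin 2) (ZMod 3)) ^ n = 1 ∨
      (!![0, 1; 1, 0] : Matrix (Fin 2) (Fin 2) (ZMod 3)) ^ n = !![0, 1; 1, 0] := by
    intro n
    induction n with
    | zero => exact Or.inl (pow_zero _)
    | succ n ih =>
      rw [pow_succ]
      rcases ih with h | h <;> rw [h]
      · exact Or.inr (one_mul _)
      · left
        decide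
  -- At `X = 0` the matrix of the letter `X` is an involution, so only the parity of the exponent
  -- and the sign from `cfMat_block` matter: four matrices, each checked on all pairs `(s, t)`.
  have hmat : ev (equationMat k) = !![0, -1; 1, 0] ∨ ev (equationMat k) = -!![0, -1; 1, 0] ∨
      ev (equationMat k) = !![0, -1; -1, -1] ∨ ev (equationMat k) = -!![0, -1; -1, -1] := by
    have hB : ev (blockMat 0 ((k + 2) * 3 ^ 0)) * ev (transfer 0) = !![0, -1; 1, 0] ∨
        ev (blockMat 0 ((k + 2) * 3 ^ 0)) * ev (transfer 0) = !![0, -1; -1, -1] := by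
      rw [blockMat, if_pos (by decide), map_mul, map_mul, map_pow, hJ, hU, hL, hT]
      rcases hpow ((k + 2) * 3 ^ 0) with h | h <;> rw [h] <;> decide
    rw [equationMat, map_mul]
    rcases cfMat_block k 0 with h | h <;> rw [h]
    · tauto
    · rw [map_neg, neg_mul]
      rcases hB with h | h <;> rw [h] <;> tauto
  simp only [eval_neg, hev] at h
  rcases hmat with hm | hm | hm | hm <;> rw [hm] at h <;> revert s t <;> decide

end QuarticRelation

/-! ### Degree exactly four over the rational functions -/

section Quartic

variable {K : Type*} [Field K]

theorem polyEmb_mem (P : K[X]) : polyEmb K P ∈ ratFunField K :=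
  Subfield.subset_closure ⟨P, rfl⟩

/-- The embedding of the polynomials in the field of rational functions. -/
def toRatFun (K : Type*) [Field K] : K[X] →+* ratFunField K :=
  (polyEmb K).codRestrict (ratFunField K) polyEmb_mem

theorem coe_toRatFun (P : K[X]) : ((toRatFun K P : ratFunField K) : LaurentSeries K) =
    polyEmb K P := rfl

theorem toRatFun_eq_zero {P : K[X]} : toRatFun K P = 0 ↔ P = 0 := by
  rw [← polyEmb_eq_zero, ← coe_toRatFun, ZeroMemClass.coe_eq_zero]

theorem exists_div (r : ratFunField K) :
    ∃ P Q : K[X], Q ≠ 0 ∧ r = toRatFun K P / toRatFun K Q := by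
  obtain ⟨r, hr⟩ := r
  obtain ⟨y, hy, z, hz, rfl⟩ := Subfield.mem_closure_iff.mp hr
  rw [← RingHom.coe_range, Subring.closure_eq] at hy hz
  obtain ⟨P, rfl⟩ := hy
  obtain ⟨Q, rfl⟩ := hz
  by_cases hQ : Q = 0
  · refine ⟨0, 1, one_ne_zero, Subtype.ext ?_⟩
    simp [hQ]
  · exact ⟨P, Q, hQ, Subtype.ext rfl⟩

theorem exists_coprime_div (r : ratFunField K) :
    ∃ P Q : K[X], Q ≠ 0 ∧ IsCoprime P Q ∧ r = toRatFun K P / toRatFun K Q := by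
  classical
  obtain ⟨P, Q, hQ, hr⟩ := exists_div r
  have hg : EuclideanDomain.gcd P Q ≠ 0 := fun h => hQ (EuclideanDomain.gcd_eq_zero_iff.mp h).2
  obtain ⟨P', hP'⟩ := EuclideanDomain.gcd_dvd_left P Q
  obtain ⟨Q', hQ'⟩ := EuclideanDomain.gcd_dvd_right P Q
  have hQ0 : Q' ≠ 0 := by
    rintro rfl
    rw [mul_zero] at hQ'
    exact hQ hQ'
  refine ⟨P', Q', hQ0, ?_, ?_⟩
  · refine ⟨EuclideanDomain.gcdA P Q, EuclideanDomain.gcdB P Q, mul_left_cancel₀ hg ?_⟩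
    have := EuclideanDomain.gcd_eq_gcd_ab P Q
    linear_combination -this + EuclideanDomain.gcdA P Q * -hP' +
      EuclideanDomain.gcdB P Q * -hQ'
  · rw [hr, congrArg (toRatFun K) hP', congrArg (toRatFun K) hQ', map_mul, map_mul,
      mul_div_mul_left _ _ (toRatFun_eq_zero.not.mpr hg)]

/-- Homogenise at a reduced fraction and evaluate at `0`: numerator and denominator would both
vanish there, contrary to coprimality. -/
theorem no_root_of_no_root_mod {e₀ e₁ e₃ e₄ : K[X]}
    (hroot : ∀ s t : K, e₀.eval 0 * t ^ 4 + e₁.eval 0 * s * t ^ 3 + e₃.eval 0 * s ^ 3 * t +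
      e₄.eval 0 * s ^ 4 = 0 → s = 0 ∧ t = 0) (r : ratFunField K) :
    toRatFun K e₀ + toRatFun K e₁ * r + toRatFun K e₃ * r ^ 3 + toRatFun K e₄ * r ^ 4 ≠ 0 := by
  intro h
  obtain ⟨P, Q, hQ, ⟨a, b, hab⟩, rfl⟩ := exists_coprime_div r
  have hQ' := toRatFun_eq_zero.not.mpr hQ
  have hpoly : e₀ * Q ^ 4 + e₁ * P * Q ^ 3 + e₃ * P ^ 3 * Q + e₄ * P ^ 4 = 0 := by
    rw [← toRatFun_eq_zero]
    simp only [map_add, map_mul, map_pow]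
    field_simp at h
    linear_combination h
  have hev := congrArg (eval 0) hpoly
  simp only [eval_add, eval_mul, eval_pow, eval_zero] at hev
  obtain ⟨hs, ht⟩ := hroot _ _ hev
  have := congrArg (eval 0) hab
  simp [hs, ht] at this

theorem eq_zero_of_quadratic {x : LaurentSeries K}
    (hquad : ∀ a b c : K[X], polyEmb K a + polyEmb K b * x + polyEmb K c * x ^ 2 = 0 →
      a = 0 ∧ b = 0 ∧ c = 0) (a b c : ratFunField K)
    (h : (a : LaurentSeries K) + b * x + c * x ^ 2 = 0) : a = 0 ∧ b = 0 ∧ c = 0 := by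
  obtain ⟨a₁, a₂, ha, rfl⟩ := exists_div a
  obtain ⟨b₁, b₂, hb, rfl⟩ := exists_div b
  obtain ⟨c₁, c₂, hc, rfl⟩ := exists_div c
  have ha' := polyEmb_eq_zero.not.mpr ha
  have hb' := polyEmb_eq_zero.not.mpr hb
  have hc' := polyEmb_eq_zero.not.mpr hc
  have := hquad (a₁ * (b₂ * c₂)) (b₁ * (a₂ * c₂)) (c₁ * (a₂ * b₂)) (by
    simp only [map_mul]
    push_cast [coe_toRatFun] at h
    field_simp at h
    linear_combination h)
  simp only [mul_eq_zero, ha, hb, hc, or_false] at this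
  simp [this]

/-- A criterion for being quartic. -/
theorem isQuartic_of_relation {x : LaurentSeries K} {e₀ e₁ e₃ e₄ : K[X]}
    (hquad : ∀ a b c : K[X], polyEmb K a + polyEmb K b * x + polyEmb K c * x ^ 2 = 0 →
      a = 0 ∧ b = 0 ∧ c = 0)
    (hrel : polyEmb K e₀ + polyEmb K e₁ * x + polyEmb K e₃ * x ^ 3 + polyEmb K e₄ * x ^ 4 = 0)
    (hroot : ∀ s t : K, e₀.eval 0 * t ^ 4 + e₁.eval 0 * s * t ^ 3 + e₃.eval 0 * s ^ 3 * t +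
      e₄.eval 0 * s ^ 4 = 0 → s = 0 ∧ t = 0) : IsQuartic x := by
  -- The point `(1, 0)` at infinity is excluded as a root too, so the degree does not drop.
  have he₄ : toRatFun K e₄ ≠ 0 := by
    rw [Ne, toRatFun_eq_zero]
    rintro rfl
    have := hroot 1 0 (by simp)
    simp at this
  set P : (ratFunField K)[X] := C (toRatFun K e₀) + C (toRatFun K e₁) * X +
    C (toRatFun K e₃) * X ^ 3 + C (toRatFun K e₄) * X ^ 4 with hP
  have hdeg : P.natDegree = 4 := by
    rw [hP]
    compute_degree!
  have hP0 : P ≠ 0 := by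
    rintro h
    rw [h] at hdeg
    simp at hdeg
  have haeval : aeval x P = 0 := by
    rw [← hrel, hP]
    simp only [map_add, map_mul, map_pow, aeval_C, aeval_X]
    rfl
  have hint : IsIntegral (ratFunField K) x :=
    (show IsAlgebraic (ratFunField K) x from ⟨P, hP0, haeval⟩).isIntegral
  obtain ⟨ν, hν⟩ := minpoly.dvd _ x haeval
  have hμ0 := minpoly.ne_zero hint
  have hν0 : ν ≠ 0 := by
    rintro rfl
    exact hP0 (by rw [hν, mul_zero])
  have hsum : (minpoly (ratFunField K) x).natDegree + ν.natDegree = 4 := by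
    rw [← natDegree_mul hμ0 hν0, ← hν, hdeg]
  have h2 : ¬ (minpoly (ratFunField K) x).natDegree ≤ 2 := by
    intro hle
    have heq := eq_quadratic_of_degree_le_two (natDegree_le_iff_degree_le.mp hle)
    have hx := minpoly.aeval (ratFunField K) x
    rw [heq] at hx
    simp only [map_add, map_mul, map_pow, aeval_C, aeval_X] at hx
    obtain ⟨ha, hb, hc⟩ := eq_zero_of_quadratic hquad
      ((minpoly (ratFunField K) x).coeff 0) ((minpoly (ratFunField K) x).coeff 1)
      ((minpoly (ratFunField K) x).coeff 2) (by
        rw [← hx]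
        change _ = algebraMap (ratFunField K) (LaurentSeries K) _ * x ^ 2 +
          algebraMap (ratFunField K) (LaurentSeries K) _ * x +
          algebraMap (ratFunField K) (LaurentSeries K) _
        simp only [show ∀ y : ratFunField K,
          algebraMap (ratFunField K) (LaurentSeries K) y = y from fun _ => rfl]
        ring)
    apply hμ0
    rw [heq, ha, hb, hc]
    simp
  -- A minimal polynomial of degree 3 would leave a linear cofactor, hence a rational root of the
  -- quartic.
  have h3 : (minpoly (ratFunField K) x).natDegree ≠ 3 := by
    intro h3
    have hν1 : ν.natDegree = 1 := by omega
    obtain ⟨r, hr⟩ := exists_root_of_degree_eq_one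
      ((degree_eq_iff_natDegree_eq_of_pos one_pos).mpr hν1)
    refine no_root_of_no_root_mod hroot r ?_
    have : P.eval r = 0 := by
      rw [hν, eval_mul, hr.eq_zero, mul_zero]
    rw [← this, hP]
    simp
  unfold IsQuartic
  omega

end Quartic

theorem Theta_isQuartic (k : ℕ) : IsQuartic (Theta k) :=
  isQuartic_of_relation (fun _ _ _ => Theta_not_quadratic) (Theta_quartic_relation k)
    (equationMat_no_root k)

/-- The criterion applies to the reciprocal polynomial: the missing term is the middle one, and the
absence of projective roots is symmetric in `s` and `t`. -/
theorem Theta_inv_isQuartic (k : ℕ) : IsQuartic (Theta k)⁻¹ := by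
  have h0 := (Theta_approx k).ne_zero
  refine isQuartic_of_relation (e₀ := equationMat k 0 1) (e₁ := -equationMat k 1 1)
    (e₃ := equationMat k 0 0) (e₄ := -equationMat k 1 0) (fun a b c h => ?_) ?_ fun s t h => ?_
  · have := Theta_not_quadratic (k := k) (a := c) (b := b) (c := a) (by
      field_simp at h
      linear_combination h)
    tauto
  · have h := Theta_quartic_relation k
    field_simp
    linear_combination h
  · have := equationMat_no_root k t s (by linear_combination h)
    tauto

theorem Theta_littlewoodNontrivially (k : ℕ) :
    LittlewoodNontrivially (Theta k) (Theta k)⁻¹ := by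
  have h0 := (Theta_approx k).ne_zero
  refine ⟨Theta_littlewood k, (Theta_approx k).isBad, (Theta_approx k).isBad_inv,
    fun a b c h => ?_⟩
  have := Theta_not_quadratic (k := k) (a := c) (b := a) (c := b) (by
    field_simp at h
    linear_combination h)
  tauto

end PowerSeriesLittlewood

end

theorem theorem6 :
    (∀ k : ℕ,
      PowerSeriesLittlewood.HasContFrac (PowerSeriesLittlewood.partialQuotient k)
        (PowerSeriesLittlewood.Theta k) ∧
      PowerSeriesLittlewood.IsQuartic (PowerSeriesLittlewood.Theta k) ∧
      PowerSeriesLittlewood.Littlewood (PowerSeriesLittlewood.Theta k)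
        (PowerSeriesLittlewood.Theta k)⁻¹) ∧
    {P : LaurentSeries (ZMod 3) × LaurentSeries (ZMod 3) |
      PowerSeriesLittlewood.IsQuartic P.1 ∧ PowerSeriesLittlewood.IsQuartic P.2 ∧
      PowerSeriesLittlewood.LittlewoodNontrivially P.1 P.2}.Infinite := by
  refine ⟨fun k => ⟨PowerSeriesLittlewood.Theta_hasContFrac k,
    PowerSeriesLittlewood.Theta_isQuartic k, PowerSeriesLittlewood.Theta_littlewood k⟩, ?_⟩
  refine Set.infinite_of_injective_forall_mem
    (f := fun k => (PowerSeriesLittlewood.Theta k, (PowerSeriesLittlewood.Theta k)⁻¹))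
    (fun k k' h => PowerSeriesLittlewood.Theta_injective (congrArg Prod.fst h)) fun k =>
    ⟨PowerSeriesLittlewood.Theta_isQuartic k, PowerSeriesLittlewood.Theta_inv_isQuartic k,
      PowerSeriesLittlewood.Theta_littlewoodNontrivially k⟩
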